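/- **Model.** Let $G$ be a finite simple connected graph of maximum degree $\Delta$ with anonymous nodes; the edges at each node $v$ carry the port numbers $0,\dots,\deg(v)-1$ in an arbitrary order. A treasure lies at a node $t$ at distance $D$ from the start node $s$. A deterministic agent with unbounded memory starts at $s$. At each node it sees only the degree of the node, the port through which it entered, and whether the node carries a pebble; it knows nothing about $G$, $D$, $\Delta$, $k$ or the positions of pebbles and treasure. Time is the number of edge traversals until the agent first reaches $t$. **Oracle.** Let $k<D/2$, let $\eta=\lfloor k/3\rfloor$, and let $l$ be, rounded up to an integer, $$\frac{D-\eta}{2\eta+1}\ (k=3\eta),\qquad \frac{D-\eta}{2\eta+2}\ (k=3\eta+1),\qquad \frac{D-\eta-1}{2\eta+2}\ (k=3\eta+2).$$ Let $v_0=s,v_1,\dots,v_D=t$ be any shortest $s$–$t$ path. A group consists of a marker (pebbles at two consecutive nodes of the path) and a single pebble $l$ after the marker; the first marker begins $l$ after $s$, and each later one $l$ after the preceding single pebble. Thus the pebbles $3i,3i+1,3i+2$ have the positions $i(2l+1)+l$, $i(2l+1)+l+1$, $(i+1)(2l+1)$ on the path. The oracle places the pebbles $0,\dots,k-1$ of this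 sequence (omitting those whose position would be at least $D$, which can happen only if $l$ had to be rounded). **Algorithm TreasureHuntForGraphWithMarker.** The agent searches the levels $1,2,\dots$ around $s$ (level $d$: all walks of length $d$, in lexicographic order of outgoing ports) until, after completing a level, it has met a pebble. It goes there; the level is stored as the length $l$. Whenever it has reached a new pebble, it inspects the neighbours of that node. If a neighbour carries a pebble, a marker is found: the agent moves to that neighbour, which becomes the SearchNode, stores the incoming port as its return sequence, and has no other stored ports. Otherwise the new pebble is the SearchNode; its return sequence is empty if it was reached from $s$, and is the reversed route just used followed by the previous return sequence otherwise; moreover the agent stores the ports through which the searched walks of length $l$ to the new pebble entered it. From the SearchNode it searches all walks of length $l$ whose first port is not stored. At a pebble met at the end of such a walk it inspects the neighbours. If one of them carries a pebble, the pebble counts as new iff the SearchNode is not in a marker. Otherwise it counts as new iff travelling the stored return sequence from there does not end with an edge joining two pebbled nodes. The agent completes the search, moves to the first new pebble found, and repeats. **Theorem.** There is an absolute constant $C>0$ such that for all $G$, port labellings, $s$, $t$, $k<D/2$ and shortest $s$–$t$ paths as above, the oracle places at most $k$ pebbles and the agent running TreasureHuntForGraphWithMarker reaches the treasure within time $C\,D\,\Delta^{\,l}$.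 Consequently, whenever $l\le D/(2\eta+1)$, in particular whenever the quotient defining $l$ is an integer, the time is at most $C\,D\,\Delta^{D/(2\eta+1)}$, i.e. $\mathcal O\bigl(D\Delta^{D/(2\eta+1)}\bigr)$. -/

import Mathlib

namespace PebbleHunt

/-! ### Anonymous port-labelled graphs -/

/-- A port labelling of `G`: at every node `v` the incident edges carry the port numbers
`0, …, deg v - 1`, in an arbitrary fixed order; `nbr v p` is the neighbour behind port `p`. -/
structure PortLabelling {V : Type*} (G : SimpleGraph V) [G.LocallyFinite] where
  nbr : (v : V) → Fin (G.degree v) ≃ G.neighborSet v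

/-- What the agent perceives on arriving at a node: its degree, the number (at this node) of the
port through which it came in, and whether the node carries a pebble. Node names, the positions
of other pebbles, `D`, `Δ` and `k` are invisible. -/
structure View where
  deg : ℕ
  inPort : ℕ
  pebble : Bool

/-! ### Agent programs -/

/-- A finite interactive program of an agent with unbounded memory: leave through a port and
continue according to what is then perceived, or stop and return a value. -/
inductive Prog (α : Type) : Type where
  | done (a : α) : Prog α
  | move (p : ℕ) (next : View → Prog α) : Prog α

namespace Prog

/-- Sequential composition of programs. -/
def bind {α β : Type} : Prog α → (α → Prog β) → Prog β
  | done a, f => f a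
  | move p next, f => move p (fun o => (next o).bind f)

instance : Monad Prog where
  pure := done
  bind := bind

/-- Traverse one edge. -/
def go (p : ℕ) : Prog View := move p done

/-- Execute `f` for all entries of a list, in order, and concatenate the results. -/
def collect {β γ : Type} (f : β → Prog (List γ)) : List β → Prog (List γ)
  | [] => pure []
  | b :: bs => do
      let r ← f b
      let rs ← collect f bs
      pure (r ++ rs)

end Prog

section Execution

variable {V : Type*} {G : SimpleGraph V} [G.LocallyFinite]

/-- The node reached from `v` through port `p` (the agent stays at `v` if there is no such port). -/
def PortLabelling.step (L : PortLabelling G) (v : V) (p : ℕ) : V :=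
  if h : p < G.degree v then (L.nbr v ⟨p, h⟩ : V) else v

/-- What the agent perceives after leaving `v` through port `p`. -/
def PortLabelling.view [DecidableEq V] (L : PortLabelling G) (pebbles : Finset V) (v : V) (p : ℕ) :
    View where
  deg := G.degree (L.step v p)
  inPort :=
    if h : p < G.degree v then
      ((L.nbr (L.nbr v ⟨p, h⟩ : V)).symm ⟨v, ((L.nbr v ⟨p, h⟩).2 : G.Adj _ _).symm⟩ : ℕ)
    else 0
  pebble := decide (L.step v p ∈ pebbles)

/-- Execution of a program from node `v`: the list of nodes entered (one for every edge
traversal), the final node and the returned value. -/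
def Prog.run [DecidableEq V] {α : Type} (L : PortLabelling G) (pebbles : Finset V) :
    Prog α → V → List V × V × α
  | .done a, v => ([], v, a)
  | .move p next, v =>
      let r := Prog.run L pebbles (next (L.view pebbles v p)) (L.step v p)
      (L.step v p :: r.1, r.2)

end Execution

/-- A deterministic agent, given as an endless repetition of rounds. A round starts from the
memory left by the previous one and from the degree of the current node. The agent need not
react to the treasure, since the hunt is over as soon as it is reached. -/
structure Agent where
  Memory : Type
  init : Memory
  round : Memory → ℕ → Prog Memory

section Execution

variable {V : Type*} [DecidableEq V] {G : SimpleGraph V} [G.LocallyFinite]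

/-- The first `n` rounds of an agent starting at `s`: the list of all nodes occupied, in order and
beginning with `s`, the current node and the memory. -/
def Agent.rounds (A : Agent) (L : PortLabelling G) (pebbles : Finset V) (s : V) :
    ℕ → List V × V × A.Memory
  | 0 => ([s], s, A.init)
  | n + 1 =>
      let c := A.rounds L pebbles s n
      let r := (A.round c.2.2 (G.degree c.2.1)).run L pebbles c.2.1
      (c.1 ++ r.1, r.2)

/-- After exactly `T` edge traversals the agent, started at `s`, is at `t`. -/
def Agent.VisitsAt (A : Agent) (L : PortLabelling G) (pebbles : Finset V) (s t : V) (T : ℕ) :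
    Prop :=
  ∃ n, (A.rounds L pebbles s n).1[T]? = some t

end Execution

/-! ### The oracle -/

/-- The spacing `l`: with `η = ⌊k/3⌋` it is `(D - η)/(2η + 1)`, `(D - η)/(2η + 2)` or
`(D - η - 1)/(2η + 2)`, according to `k = 3η`, `3η + 1`, `3η + 2`, rounded up to an integer. -/
def spacing (k D : ℕ) : ℕ :=
  if k % 3 = 0 then (D - k / 3) ⌈/⌉ (2 * (k / 3) + 1)
  else if k % 3 = 1 then (D - k / 3) ⌈/⌉ (2 * (k / 3) + 2)
  else (D - k / 3 - 1) ⌈/⌉ (2 * (k / 3) + 2)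

/-- The distance from `s` of the `j`-th pebble (`j = 0, 1, …`). Group `i` consists of the pebbles
`3i`, `3i + 1` (a marker: two adjacent nodes) and `3i + 2` (a single pebble, `l` after the marker);
the first marker is `l` after `s`, every further marker `l` after the preceding single pebble. -/
def pebblePos (l j : ℕ) : ℕ :=
  if j % 3 = 0 then (j / 3) * (2 * l + 1) + l
  else if j % 3 = 1 then (j / 3) * (2 * l + 1) + l + 1
  else (j / 3 + 1) * (2 * l + 1)

/-- The nodes of a shortest `s`–`t` path `P` on which the oracle, given `k` pebbles, places one:
the positions `pebblePos l j` with `j < k` on `P` that precede the treasure. (If no rounding took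
place in `spacing`, all `k` positions precede it.) -/
def markerPlacement {V : Type*} [DecidableEq V] {G : SimpleGraph V} {s t : V}
    (P : G.Walk s t) (k : ℕ) : Finset V :=
  (((Finset.range k).image (pebblePos (spacing k P.length))).filter (· < P.length)).image P.getVert

/-! ### The algorithm `TreasureHuntForGraphWithMarker` -/

/-- A route: the pairs (outgoing port, incoming port) of its successive edges. -/
abbrev Route := List (ℕ × ℕ)

/-- Look at the neighbours behind the given ports one after the other, always coming back, until
one with a pebble is found; return its port. -/
def scan : List ℕ → Prog (Option ℕ)
  | [] => pure none
  | p :: ps => do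
      let o ← Prog.go p
      let _ ← Prog.go o.inPort
      if o.pebble then pure (some p) else scan ps

/-- Travel a sequence of outgoing ports and come back. The answer is `true` if the last traversed
edge joins two nodes with pebbles, i.e. if a marker is found; it is `false` if not, or if the
sequence is empty or cannot be travelled. Here `deg` and `peb` describe the current node. -/
def leadsToMarker : List ℕ → (deg : ℕ) → (peb : Bool) → Prog Bool
  | [], _, _ => pure false
  | p :: ps, deg, peb =>
      if p < deg then do
        let o ← Prog.go p
        let b ← if ps.isEmpty then pure (peb && o.pebble) else leadsToMarker ps o.deg o.pebble
        let _ ← Prog.go o.inPort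
        pure b
      else pure false

/-- Search all paths of length `d` from the current node (of degree `deg`, with a pebble iff
`peb`), in lexicographic order of the outgoing ports and not using the ports `skip` for the first
step, and come back. Whenever such a path ends at a pebble, `test` (given the degree of that node)
is performed there. The result is the list of all routes for which `test` succeeded. -/
def sweep (test : ℕ → Prog Bool) : (d deg : ℕ) → (peb : Bool) → (skip : List ℕ) → Prog (List Route)
  | 0, deg, peb, _ =>
      if peb then do
        let b ← test deg
        pure (if b then [[]] else [])
      else pure []
  | d + 1, deg, _, skip =>
      Prog.collect (fun p => do
        let o ← Prog.go p
        let rs ← sweep test d o.deg o.pebble []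
        let _ ← Prog.go o.inPort
        pure (rs.map ((p, o.inPort) :: ·))) ((List.range deg).filter (· ∉ skip))

/-- Travel a route from a node of degree `deg`; return the degree of its last node. -/
def travel : Route → (deg : ℕ) → Prog ℕ
  | [], deg => pure deg
  | e :: r, _ => do
      let o ← Prog.go e.1
      travel r o.deg

/-- The memory of the agent between two rounds. Its current node is the `SearchNode`.
`start d`: at `s`, and the levels `1, …, d - 1` around `s` have been searched.
`search l atMarker back skip`: at a node with a pebble; `l` is the stored length, `atMarker` says
whether the node belongs to a marker, `back` is the stored port sequence whose last edge is the
last marker found (empty for a single pebble reached from `s` itself), `skip` are the stored incoming ports. -/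
inductive Mem where
  | start (d : ℕ)
  | search (l : ℕ) (atMarker : Bool) (back skip : List ℕ)

/-- Performed at a pebble encountered in a search: is it new (`true`), or has the agent circled
back to the `SearchNode`? A pebble with a pebble next to it belongs to a marker, and then it is new
iff the `SearchNode` does not. Otherwise it is new iff the stored port sequence, travelled from
here, does not lead to a marker. -/
def isNew (atMarker : Bool) (back : List ℕ) (deg : ℕ) : Prog Bool := do
  match ← scan (List.range deg) with
  | some _ => pure (!atMarker)
  | none => do
      let b ← leadsToMarker back deg true
      pure (!b)

/-- Move to the new pebble at the end of the first of the given routes and search its neighbours.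
If one of them has a pebble, a marker is found: go there, this is the new `SearchNode`, and store
the incoming port. Otherwise the pebble is the new `SearchNode`; store the port sequence leading
back, and the incoming ports of all the routes. -/
def advance (l deg : ℕ) (back : List ℕ) (r : Route) (rs : List Route) : Prog Mem := do
  let g ← travel r deg
  match ← scan (List.range g) with
  | some p => do
      let o ← Prog.go p
      pure (Mem.search l true [o.inPort] [])
  | none =>
      pure (Mem.search l false back ((r :: rs).filterMap (fun q => q.getLast?.map Prod.snd)))

/-- One round: from `s`, search the next level, until a pebble is met; from a later `SearchNode`,
search all paths of length `l` (with the stored ports barred from the first step) and move on to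
the new pebble. -/
def huntRound : Mem → (deg : ℕ) → Prog Mem
  | .start d, deg => do
      match ← sweep (fun _ => pure true) d deg false [] with
      | [] => pure (.start (d + 1))
      | r :: rs => advance d deg [] r rs
  | .search l atMarker back skip, deg => do
      match ← sweep (isNew atMarker back) l deg true skip with
      | [] => pure (.search l atMarker back skip)
      | r :: rs => advance l deg ((r.map Prod.snd).reverse ++ back) r rs

/-- The agent that executes `TreasureHuntForGraphWithMarker`. -/
def treasureHuntForGraphWithMarker : Agent where
  Memory := Mem
  init := .start 1
  round := huntRound

end PebbleHunt

/-! Every node is measured by its distance `f` from `s`. The pebbles lie on one shortest path, so a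
pebble is determined by its level, and a walk of length `l` changes the level by at most `l`. With
`m = 2 * l + 1`, the marker `i` has the levels `i * m + l` and `i * m + l + 1`, and the single
pebble `i` has level `(i + 1) * m`; hence each search can meet only very few pebbles, and all but
one of them must be rejected.

From the second node of a marker the pebbles in reach are the marker itself, rejected because its
nodes have pebbled neighbours, and the next single pebble, which is isolated (`marker_round`). From
a single pebble they are three. The second node of the preceding marker is exactly `l` levels below,
and every walk of length `l` to it reverses a walk of the preceding search, so its first port is
barred. The single pebble itself is recognised because its return sequence leads to the marker. What
remains is the first node of the next marker (`single_round`). Barred ports lead to lower levels, so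
the shortest path onwards is never barred. As `spacing` puts the treasure at most `l` beyond the
last pebble, some search finally passes through it.

For the time, there are about `Δ ^ l` walks per search, but a test costs up to order `Δ + l`, and
testing at the end of every walk would be too slow. Each node has at most three pebbled neighbours,
one per adjacent level (`countP_le`), so at most `3 * Δ ^ (l - 1)` tests occur and a search costs
O(`l * Δ ^ l`) (`sweep_length`, `sweepCost_le`). There are two searches per group, and `(2 * (k / 3)
+ 1) * l ≤ 2 * D` by `spacing_bounds`, which gives O(`D * Δ ^ l`). -/

namespace PebbleHunt

section Execution

variable {V : Type*} [DecidableEq V] {G : SimpleGraph V} [G.LocallyFinite]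
  {L : PortLabelling G} {B : Finset V}

/-! ### Execution of composed programs -/

@[simp] theorem Prog.run_pure {α : Type} (a : α) (v : V) :
    (pure a : Prog α).run L B v = ([], v, a) := rfl

@[simp] theorem Prog.run_go (p : ℕ) (v : V) :
    (Prog.go p).run L B v = ([L.step v p], L.step v p, L.view B v p) := rfl

@[simp] theorem Prog.run_bind {α β : Type} (x : Prog α) (g : α → Prog β) (v : V) :
    (x >>= g).run L B v =
      ((x.run L B v).1 ++ ((g (x.run L B v).2.2).run L B (x.run L B v).2.1).1,
        ((g (x.run L B v).2.2).run L B (x.run L B v).2.1).2) := by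
  change (x.bind g).run L B v = _
  induction x generalizing v with
  | done a => simp [Prog.bind, Prog.run]
  | move p next ih => simp [Prog.bind, Prog.run, ih]

/-! ### Ports and views -/

namespace PortLabelling

section Ports

variable {V : Type*} {G : SimpleGraph V} [G.LocallyFinite] {L : PortLabelling G}

/-- The port at `L.step v p` of the edge leading back to `v`. -/
def inPort (L : PortLabelling G) (v : V) (p : ℕ) : ℕ :=
  if h : p < G.degree v then
    ((L.nbr (L.nbr v ⟨p, h⟩ : V)).symm ⟨v, ((L.nbr v ⟨p, h⟩).2 : G.Adj _ _).symm⟩ : ℕ)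
  else 0

theorem step_eq {v : V} {p : ℕ} (h : p < G.degree v) : L.step v p = L.nbr v ⟨p, h⟩ :=
  dif_pos h

theorem step_symm (v : V) (x : G.neighborSet v) : L.step v ((L.nbr v).symm x) = x := by
  rw [step_eq (Fin.is_lt _)]
  simp

theorem step_adj {v : V} {p : ℕ} (h : p < G.degree v) : G.Adj v (L.step v p) := by
  rw [step_eq h]
  exact (L.nbr v ⟨p, h⟩).2

theorem exists_step {v w : V} (h : G.Adj v w) : ∃ p < G.degree v, L.step v p = w :=
  ⟨(L.nbr v).symm ⟨w, h⟩, Fin.is_lt _, step_symm v ⟨w, h⟩⟩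

theorem step_injOn (v : V) : Set.InjOn (L.step v) {p | p < G.degree v} := by
  intro p (hp : p < _) q (hq : q < _) h
  rw [step_eq hp, step_eq hq] at h
  simpa using (L.nbr v).injective (Subtype.ext h)

theorem inPort_lt {v : V} {p : ℕ} (h : p < G.degree v) :
    L.inPort v p < G.degree (L.step v p) := by
  rw [inPort, dif_pos h, step_eq h]
  exact Fin.is_lt _

theorem step_inPort {v : V} {p : ℕ} (h : p < G.degree v) :
    L.step (L.step v p) (L.inPort v p) = v := by
  rw [inPort, dif_pos h, step_eq h, step_symm]

theorem inPort_inPort {v : V} {p : ℕ} (h : p < G.degree v) :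
    L.inPort (L.step v p) (L.inPort v p) = p := by
  apply step_injOn (L := L) v
  · have := inPort_lt (L := L) (inPort_lt (L := L) h)
    rwa [step_inPort h] at this
  · exact h
  · have := step_inPort (L := L) (inPort_lt (L := L) h)
    rwa [step_inPort h] at this

end Ports

@[simp] theorem view_inPort (v : V) (p : ℕ) : (L.view B v p).inPort = L.inPort v p := rfl

@[simp] theorem view_deg (v : V) (p : ℕ) : (L.view B v p).deg = G.degree (L.step v p) := rfl

@[simp] theorem view_pebble (v : V) (p : ℕ) :
    (L.view B v p).pebble = decide (L.step v p ∈ B) := rfl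

section Routes

variable {V : Type*} {G : SimpleGraph V} [G.LocallyFinite] {L : PortLabelling G} {B : Finset V}

/-- `r` is the route of a walk from `v` to `u`. -/
def IsRoute (L : PortLabelling G) : V → Route → V → Prop
  | v, [], u => v = u
  | v, e :: r, u => e.1 < G.degree v ∧ e.2 = L.inPort v e.1 ∧ L.IsRoute (L.step v e.1) r u

theorem IsRoute.append {x y z : V} {r r' : Route} (h : L.IsRoute x r y) (h' : L.IsRoute y r' z) :
    L.IsRoute x (r ++ r') z := by
  induction r generalizing x with
  | nil => obtain rfl : x = y := h; exact h'
  | cons e r ih => exact ⟨h.1, h.2.1, ih h.2.2⟩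

theorem IsRoute.exists_of_append {x z : V} {r r' : Route} (h : L.IsRoute x (r ++ r') z) :
    ∃ y, L.IsRoute x r y ∧ L.IsRoute y r' z := by
  induction r generalizing x with
  | nil => exact ⟨x, rfl, h⟩
  | cons e r ih =>
    obtain ⟨y, hy, hz⟩ := ih h.2.2
    exact ⟨y, ⟨h.1, h.2.1, hy⟩, hz⟩

theorem IsRoute.reverse {x y : V} {r : Route} (h : L.IsRoute x r y) :
    L.IsRoute y (r.map Prod.swap).reverse x := by
  induction r generalizing x with
  | nil => exact Eq.symm h
  | cons e r ih =>
    obtain ⟨h1, h2, h3⟩ := h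
    rw [List.map_cons, List.reverse_cons]
    refine (ih h3).append ⟨?_, ?_, ?_⟩
    · simpa [h2] using inPort_lt h1
    · simpa [h2] using (inPort_inPort h1).symm
    · simpa [h2, IsRoute] using step_inPort h1

/-- The ports `ps` can be travelled from `v`, and the last edge joins two nodes with pebbles. -/
def Leads (L : PortLabelling G) (B : Finset V) : V → List ℕ → Prop
  | _, [] => False
  | v, p :: ps => p < G.degree v ∧
      if ps = [] then v ∈ B ∧ L.step v p ∈ B else L.Leads B (L.step v p) ps

/-- The incoming ports of a route, read backwards, are the outgoing ports of the reversed route.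
This justifies the way the agent extends its return sequence. -/
theorem Leads.reverse_append {x y : V} {r : Route} {ps : List ℕ} (h : L.Leads B x ps)
    (hr : L.IsRoute x r y) : L.Leads B y ((r.map Prod.snd).reverse ++ ps) := by
  induction r generalizing x ps with
  | nil => obtain rfl : x = y := hr; exact h
  | cons e r ih =>
    obtain ⟨h1, h2, h3⟩ := hr
    rw [List.map_cons, List.reverse_cons, List.append_assoc]
    refine ih ?_ h3
    have hps : ps ≠ [] := by rintro rfl; exact h
    rw [List.singleton_append, Leads, if_neg hps, h2, step_inPort h1]
    exact ⟨inPort_lt h1, h⟩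

end Routes

end PortLabelling

/-! ### Specifications of the subroutines -/

/-- The claim about the trace matters when the treasure lies next to a pebble: an unsuccessful
inspection of the neighbours already visits it. -/
theorem scan_run (v : V) (ps : List ℕ) (hps : ∀ p ∈ ps, p < G.degree v) :
    ∃ tr o, (scan ps).run L B v = (tr, v, o) ∧ tr.length ≤ 2 * ps.length ∧
      (∀ p, o = some p → p ∈ ps ∧ L.step v p ∈ B) ∧
      (o = none → ∀ p ∈ ps, L.step v p ∉ B ∧ L.step v p ∈ tr) := by
  induction ps with
  | nil => exact ⟨[], none, rfl, by simp⟩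
  | cons p ps ih =>
    obtain ⟨tr, o, h1, h2, h3, h4⟩ := ih fun q hq => hps q (by simp [hq])
    have hp := hps p (by simp)
    by_cases hB : L.step v p ∈ B
    · refine ⟨[L.step v p, v], some p, ?_, ?_, ?_, ?_⟩
      · simp [scan, hB, PortLabelling.step_inPort hp]
      · simp
      · simp [hB]
      · simp
    · refine ⟨L.step v p :: v :: tr, o, ?_, ?_, ?_, ?_⟩
      · simp [scan, hB, PortLabelling.step_inPort hp, h1]
      · simp; omega
      · intro q hq
        exact ⟨by simp [(h3 q hq).1], (h3 q hq).2⟩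
      · intro ho q hq
        rcases List.mem_cons.1 hq with rfl | hq
        · simp [hB]
        · exact ⟨(h4 ho q hq).1, by simp [(h4 ho q hq).2]⟩

theorem leadsToMarker_run (v : V) (ps : List ℕ) :
    ∃ tr b, (leadsToMarker ps (G.degree v) (decide (v ∈ B))).run L B v = (tr, v, b) ∧
      tr.length ≤ 2 * ps.length ∧ (b = true ↔ L.Leads B v ps) := by
  induction ps generalizing v with
  | nil => exact ⟨[], false, rfl, by simp [PortLabelling.Leads]⟩
  | cons p ps ih =>
    by_cases hp : p < G.degree v
    · obtain ⟨tr, b, h1, h2, h3⟩ := ih (L.step v p)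
      by_cases hps : ps = []
      · subst hps
        exact ⟨[L.step v p, v], decide (v ∈ B) && decide (L.step v p ∈ B),
          by simp [leadsToMarker, hp, PortLabelling.step_inPort hp], by simp,
          by simp [PortLabelling.Leads, hp]⟩
      · exact ⟨L.step v p :: (tr ++ [v]), b,
          by simp [leadsToMarker, hp, hps, PortLabelling.step_inPort hp, h1], by simp; omega,
          by simp [PortLabelling.Leads, hp, hps, h3]⟩
    · exact ⟨[], false, by simp [leadsToMarker, hp], by simp, by simp [PortLabelling.Leads, hp]⟩

theorem travel_run {v u : V} {r : Route} (h : L.IsRoute v r u) :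
    ∃ tr, (travel r (G.degree v)).run L B v = (tr, u, G.degree u) ∧ tr.length = r.length := by
  induction r generalizing v with
  | nil => obtain rfl : v = u := h; exact ⟨[], rfl, rfl⟩
  | cons e r ih =>
    obtain ⟨tr, h1, h2⟩ := ih h.2.2
    exact ⟨L.step v e.1 :: tr, by simp [travel, h1], by simp [h2]⟩

theorem isNew_run {Δ : ℕ} (hΔ : ∀ v, G.degree v ≤ Δ) (am : Bool) (back : List ℕ) {v : V}
    (hv : v ∈ B) :
    ∃ tr b, (isNew am back (G.degree v)).run L B v = (tr, v, b) ∧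
      tr.length ≤ 2 * Δ + 2 * back.length := by
  obtain ⟨tr, o, h1, h2, h3, h4⟩ :=
    scan_run (L := L) (B := B) v (List.range (G.degree v)) (by simp)
  obtain ⟨tr', b, h1', h2', h3'⟩ := leadsToMarker_run (L := L) (B := B) v back
  have hd := hΔ v
  simp only [List.length_range] at h2
  simp only [hv, decide_true] at h1'
  cases o with
  | some p => exact ⟨tr, !am, by simp [isNew, h1], by omega⟩
  | none => exact ⟨tr ++ tr', !b, by simp [isNew, h1, h1'], by simp; omega⟩

end Execution

/-! ### Exhaustive search: its result, trace and cost -/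

section Execution

variable {V : Type*} [DecidableEq V] {G : SimpleGraph V} [G.LocallyFinite]
  {L : PortLabelling G} {B : Finset V}

/-- Since each item ends where it began, every item is executed from the same node, independently of
the others. -/
theorem collect_run {β γ : Type} (g : β → Prog (List γ)) (v : V) (ps : List β)
    (h : ∀ p ∈ ps, ((g p).run L B v).2.1 = v) :
    (Prog.collect g ps).run L B v =
      (ps.flatMap fun p => ((g p).run L B v).1, v, ps.flatMap fun p => ((g p).run L B v).2.2) := by
  induction ps with
  | nil => rfl
  | cons p ps ih =>
    have hp := h p (by simp)
    have := ih fun q hq => h q (by simp [hq])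
    simp [Prog.collect, hp, this]

/-- The condition that a route does not start with one of the ports `skip`. -/
def Avoids (skip : List ℕ) (r : Route) : Prop := ∀ e ∈ r.head?, e.1 ∉ skip

@[simp] theorem avoids_nil (r : Route) : Avoids [] r := by simp [Avoids]

@[simp] theorem avoids_cons (skip : List ℕ) (e : ℕ × ℕ) (r : Route) :
    Avoids skip (e :: r) ↔ e.1 ∉ skip := by simp [Avoids]

/-- A test is performed in place, within `c` edge traversals. -/
def InPlace (L : PortLabelling G) (B : Finset V) (test : ℕ → Prog Bool) (c : ℕ) : Prop :=
  ∀ u ∈ B, ((test (G.degree u)).run L B u).2.1 = u ∧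
    ((test (G.degree u)).run L B u).1.length ≤ c

theorem sweep_end {test : ℕ → Prog Bool} {c : ℕ} (ht : InPlace L B test c) (d : ℕ) (v : V)
    (skip : List ℕ) :
    ((sweep test d (G.degree v) (decide (v ∈ B)) skip).run L B v).2.1 = v := by
  induction d generalizing v skip with
  | zero =>
    by_cases hv : v ∈ B
    · simp [sweep, hv, (ht v hv).1]
    · simp [sweep, hv]
  | succ d ih =>
    rw [sweep, collect_run]
    intro p hp
    have hp : p < G.degree v := by simp at hp; exact hp.1
    simp [ih, PortLabelling.step_inPort hp]

theorem sweep_succ_run {test : ℕ → Prog Bool} {c : ℕ} (ht : InPlace L B test c) (d : ℕ) (v : V)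
    (peb : Bool) (skip : List ℕ) :
    (sweep test (d + 1) (G.degree v) peb skip).run L B v =
      (((List.range (G.degree v)).filter (· ∉ skip)).flatMap fun p =>
        L.step v p :: (((sweep test d (G.degree (L.step v p)) (decide (L.step v p ∈ B)) []).run
          L B (L.step v p)).1 ++ [v]), v,
      ((List.range (G.degree v)).filter (· ∉ skip)).flatMap fun p =>
        ((sweep test d (G.degree (L.step v p)) (decide (L.step v p ∈ B)) []).run
          L B (L.step v p)).2.2.map ((p, L.inPort v p) :: ·)) := by
  have key : ∀ p ∈ (List.range (G.degree v)).filter (· ∉ skip), p < G.degree v := by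
    intro p hp
    simp at hp; exact hp.1
  rw [sweep, collect_run]
  · refine Prod.ext ?_ (Prod.ext rfl ?_)
    · refine List.flatMap_congr fun p hp => ?_
      simp [sweep_end ht, PortLabelling.step_inPort (key p hp)]
    · refine List.flatMap_congr fun p hp => ?_
      simp
  · intro p hp
    simp [sweep_end ht, PortLabelling.step_inPort (key p hp)]

/-- The routes found by a search. -/
theorem mem_sweep_iff {test : ℕ → Prog Bool} {c : ℕ} (ht : InPlace L B test c) (d : ℕ) (v : V)
    (skip : List ℕ) (r : Route) :
    r ∈ ((sweep test d (G.degree v) (decide (v ∈ B)) skip).run L B v).2.2 ↔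
      r.length = d ∧ Avoids skip r ∧
        ∃ u ∈ B, L.IsRoute v r u ∧ ((test (G.degree u)).run L B u).2.2 = true := by
  induction d generalizing v skip r with
  | zero =>
    by_cases hv : v ∈ B
    · cases hb : ((test (G.degree v)).run L B v).2.2
      all_goals
        cases r <;> simp [sweep, hv, hb, PortLabelling.IsRoute, Avoids]
    · cases r <;> simp [sweep, hv, PortLabelling.IsRoute]
  | succ d ih =>
    rw [sweep_succ_run ht]
    simp only [List.mem_flatMap, List.mem_filter, List.mem_range, List.mem_map, ih,
      decide_eq_true_eq]
    constructor
    · rintro ⟨p, ⟨hp, hs⟩, r', ⟨h1, -, u, hu, h2, h3⟩, rfl⟩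
      exact ⟨by simp [h1], by simpa using hs, u, hu, ⟨hp, rfl, h2⟩, h3⟩
    · rintro ⟨h1, h2, u, hu, h3, h4⟩
      obtain _ | ⟨⟨p, q⟩, r⟩ := r
      · simp at h1
      · obtain ⟨hp, hq, h3⟩ := h3
        simp only at hp hq h3
        subst hq
        exact ⟨p, ⟨hp, by simpa using h2⟩, r, ⟨by simpa using h1, by simp, u, hu, h3, h4⟩, rfl⟩

/-- A search visits all nodes on the searched walks. -/
theorem mem_sweep_trace {test : ℕ → Prog Bool} {c : ℕ} (ht : InPlace L B test c) {d : ℕ} {v u : V}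
    {skip : List ℕ} {r : Route} (hr : L.IsRoute v r u) (h0 : r ≠ []) (hd : r.length ≤ d)
    (hs : Avoids skip r) (peb : Bool) :
    u ∈ ((sweep test d (G.degree v) peb skip).run L B v).1 := by
  induction d generalizing v skip r peb with
  | zero => exact absurd (List.length_eq_zero_iff.1 (Nat.le_zero.1 hd)) h0
  | succ d ih =>
    obtain _ | ⟨e, r⟩ := r
    · exact absurd rfl h0
    rw [sweep_succ_run ht, List.mem_flatMap]
    refine ⟨e.1, by simpa using ⟨hr.1, by simpa using hs⟩, ?_⟩
    by_cases h : r = []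
    · subst h
      simp [show L.step v e.1 = u from hr.2.2]
    · simp [ih (skip := []) hr.2.2 h (by simpa using hd) (by simp)]

/-- A bound for the time of a search up to length `d`, if degrees are at most `Δ`, each node has
at most three neighbours with pebbles, and each test takes time at most `c`. -/
def sweepCost (Δ c : ℕ) : ℕ → ℕ
  | 0 => c
  | 1 => 2 * Δ + 3 * c
  | d + 2 => Δ * (2 + sweepCost Δ c (d + 1))

theorem sweepCost_le {Δ : ℕ} (c d : ℕ) (h : 2 ≤ Δ ∨ d = 0) :
    sweepCost Δ c (d + 1) ≤ Δ ^ d * (4 * Δ + 3 * c) := by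
  rcases h with h | rfl
  · have key : sweepCost Δ c (d + 1) + 4 ≤ Δ ^ d * (4 * Δ + 3 * c) := by
      induction d with
      | zero => simp [sweepCost]; omega
      | succ d ih =>
        rw [sweepCost, pow_succ]
        nlinarith
    omega
  · simp [sweepCost]; omega

/-- The last step of the walks is treated apart: of the at most `Δ` ends behind one node at most
three are tested, so the test cost is multiplied by 3 instead of `Δ`. -/
theorem sweep_length {test : ℕ → Prog Bool} {c Δ : ℕ} (ht : InPlace L B test c)
    (hΔ : ∀ v, G.degree v ≤ Δ)
    (h3 : ∀ v, ((List.range (G.degree v)).countP fun p => L.step v p ∈ B) ≤ 3)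
    (d : ℕ) (v : V) (skip : List ℕ) :
    ((sweep test d (G.degree v) (decide (v ∈ B)) skip).run L B v).1.length ≤ sweepCost Δ c d := by
  have hlen : ∀ v, ((List.range (G.degree v)).filter (· ∉ skip)).length ≤ Δ := fun v =>
    (List.length_filter_le _ _).trans (by simpa using hΔ v)
  match d with
  | 0 =>
    by_cases hv : v ∈ B
    · simp [sweep, sweepCost, hv, (ht v hv).2]
    · simp [sweep, hv]
  | 1 =>
    rw [sweep_succ_run ht, List.length_flatMap, sweepCost]
    have aux : ∀ ps : List ℕ, (ps.map fun p => (L.step v p :: (((sweep test 0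
        (G.degree (L.step v p)) (decide (L.step v p ∈ B)) []).run
          L B (L.step v p)).1 ++ [v])).length).sum ≤
        2 * ps.length + (ps.countP fun p => L.step v p ∈ B) * c := by
      intro ps
      induction ps with
      | nil => simp
      | cons p ps ih =>
        rw [List.map_cons, List.sum_cons, List.countP_cons, List.length_cons]
        by_cases hp : L.step v p ∈ B
        · have := (ht _ hp).2
          simp only [sweep, hp] at ih ⊢
          simp
          simp at ih
          nlinarith
        · simp only [sweep, hp] at ih ⊢
          simp
          simp at ih
          omega
    refine (aux _).trans ?_
    have h3' := (List.filter_sublist (p := (· ∉ skip)) (l := List.range (G.degree v))).countP_le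
      (p := fun p => decide (L.step v p ∈ B))
    have h4 := Nat.mul_le_mul_right c (h3'.trans (h3 v))
    have h5 := hlen v
    omega
  | d + 2 =>
    rw [sweep_succ_run ht, List.length_flatMap, sweepCost]
    have aux : ∀ ps : List ℕ, (ps.map fun p => (L.step v p :: (((sweep test (d + 1)
        (G.degree (L.step v p)) (decide (L.step v p ∈ B)) []).run
          L B (L.step v p)).1 ++ [v])).length).sum ≤
        ps.length * (2 + sweepCost Δ c (d + 1)) := by
      intro ps
      induction ps with
      | nil => simp
      | cons p ps ih =>
        have := sweep_length ht hΔ h3 (d + 1) (L.step v p) []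
        rw [List.map_cons, List.sum_cons, List.length_cons (a := p), add_mul, add_comm]
        refine add_le_add ih ?_
        simp
        omega
    exact (aux _).trans (Nat.mul_le_mul_right _ (hlen v))

/-! ### Moving on to the next node of search -/

theorem advance_length {Δ : ℕ} (hΔ : ∀ v, G.degree v ≤ Δ) (l : ℕ) (back : List ℕ) {v u : V}
    {r : Route} (rs : List Route) (hr : L.IsRoute v r u) :
    ((advance l (G.degree v) back r rs).run L B v).1.length ≤ r.length + 2 * Δ + 1 := by
  obtain ⟨tr, h1, h2⟩ := travel_run (B := B) hr
  obtain ⟨tr', o, h1', h2', -, -⟩ :=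
    scan_run (L := L) (B := B) u (List.range (G.degree u)) (by simp)
  have hd := hΔ u
  simp only [List.length_range] at h2'
  cases o with
  | some p => simp [advance, h1, h1']; omega
  | none => simp [advance, h1, h1']; omega

theorem advance_run (l : ℕ) (back : List ℕ) {v u : V}
    {r : Route} (rs : List Route) (hr : L.IsRoute v r u) :
    ∃ tr x mem, (advance l (G.degree v) back r rs).run L B v = (tr, x, mem) ∧
      ((∃ p < G.degree u, L.step u p ∈ B ∧ x = L.step u p ∧
          mem = .search l true [L.inPort u p] []) ∨
        ((∀ p < G.degree u, L.step u p ∉ B ∧ L.step u p ∈ tr) ∧ x = u ∧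
          mem = .search l false back ((r :: rs).filterMap fun q => q.getLast?.map Prod.snd))) := by
  obtain ⟨tr, h1, h2⟩ := travel_run (B := B) hr
  obtain ⟨tr', o, h1', -, h3, h4⟩ :=
    scan_run (L := L) (B := B) u (List.range (G.degree u)) (by simp)
  simp only [List.mem_range] at h3 h4
  cases o with
  | some p =>
    have := h3 p rfl
    exact ⟨tr ++ (tr' ++ [L.step u p]), L.step u p, _, by simp [advance, h1, h1'],
      Or.inl ⟨p, this.1, this.2, rfl, rfl⟩⟩
  | none =>
    refine ⟨tr ++ tr', u, _, by simp [advance, h1, h1'], Or.inr ⟨fun p hp => ?_, rfl, rfl⟩⟩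
    exact ⟨(h4 rfl p hp).1, by simp [(h4 rfl p hp).2]⟩

end Execution

open PortLabelling

section Execution

variable {V : Type*} [DecidableEq V] {G : SimpleGraph V} [G.LocallyFinite]
  {L : PortLabelling G} {B : Finset V}

/-! ### One round of the agent -/

/-- Search all walks of length `d`; continue with `g` if nothing is found, and otherwise move to the
new pebble. -/
def searchRound (test : ℕ → Prog Bool) (d : ℕ) (peb : Bool) (skip : List ℕ)
    (back : Route → List ℕ) (m : Mem) (deg : ℕ) : Prog Mem := do
  match ← sweep test d deg peb skip with
  | [] => pure m
  | r :: rs => advance d deg (back r) r rs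

theorem searchRound_length {test : ℕ → Prog Bool} {c Δ : ℕ} (ht : InPlace L B test c)
    (hΔ : ∀ v, G.degree v ≤ Δ)
    (h3 : ∀ v, ((List.range (G.degree v)).countP fun p => L.step v p ∈ B) ≤ 3)
    (d : ℕ) (v : V) (skip : List ℕ) (back : Route → List ℕ) (m : Mem) :
    ((searchRound test d (decide (v ∈ B)) skip back m (G.degree v)).run L B v).1.length ≤
      sweepCost Δ c d + (d + 2 * Δ + 1) := by
  have h1 := sweep_length ht hΔ h3 d v skip
  rw [searchRound, Prog.run_bind, sweep_end ht]
  cases h : ((sweep test d (G.degree v) (decide (v ∈ B)) skip).run L B v).2.2 with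
  | nil => simp; omega
  | cons r rs =>
    obtain ⟨h4, -, u, -, h5, -⟩ := (mem_sweep_iff ht d v skip r).1 (by simp [h])
    have := advance_length (B := B) hΔ d (back r) rs h5
    simp
    omega

theorem mem_searchRound_trace {test : ℕ → Prog Bool} {c : ℕ} (ht : InPlace L B test c) {d : ℕ}
    {v u : V} {skip : List ℕ} {r : Route} (hr : L.IsRoute v r u) (h0 : r ≠ []) (hd : r.length ≤ d)
    (hs : Avoids skip r) (back : Route → List ℕ) (m : Mem) :
    u ∈ ((searchRound test d (decide (v ∈ B)) skip back m (G.degree v)).run L B v).1 := by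
  rw [searchRound, Prog.run_bind]
  exact List.mem_append_left _ (mem_sweep_trace ht hr h0 hd hs _)

theorem searchRound_eq_of_forall_not {test : ℕ → Prog Bool} {c : ℕ} (ht : InPlace L B test c)
    {d : ℕ} {v : V} {skip : List ℕ} (back : Route → List ℕ) (m : Mem)
    (h : ∀ r u, r.length = d → L.IsRoute v r u → u ∉ B) :
    ((searchRound test d (decide (v ∈ B)) skip back m (G.degree v)).run L B v).2 = (v, m) ∧
    ((searchRound test d (decide (v ∈ B)) skip back m (G.degree v)).run L B v).1 =
      ((sweep test d (G.degree v) (decide (v ∈ B)) skip).run L B v).1 := by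
  have h1 : ((sweep test d (G.degree v) (decide (v ∈ B)) skip).run L B v).2.2 = [] := by
    refine List.eq_nil_iff_forall_not_mem.2 fun r hr => ?_
    obtain ⟨h4, -, u, hu, h5, -⟩ := (mem_sweep_iff ht d v skip r).1 hr
    exact h r u h4 h5 hu
  rw [searchRound, Prog.run_bind, sweep_end ht, h1]
  simp

/-- The outcome of a round if all new pebbles found lie at the same node. -/
theorem searchRound_run {test : ℕ → Prog Bool} {c : ℕ} (ht : InPlace L B test c) {d : ℕ}
    {v u : V} {skip : List ℕ} (back : Route → List ℕ) (m : Mem) (hu : u ∈ B)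
    (hN : ((test (G.degree u)).run L B u).2.2 = true) {r₀ : Route} (hr₀ : L.IsRoute v r₀ u)
    (hd : r₀.length = d) (hs : Avoids skip r₀)
    (huniq : ∀ r x, r.length = d → Avoids skip r → L.IsRoute v r x → x ∈ B →
      ((test (G.degree x)).run L B x).2.2 = true → x = u) :
    ∃ tr x mem,
      (searchRound test d (decide (v ∈ B)) skip back m (G.degree v)).run L B v = (tr, x, mem) ∧
      ((∃ p < G.degree u, L.step u p ∈ B ∧ x = L.step u p ∧
          mem = .search d true [L.inPort u p] []) ∨
        ((∀ p < G.degree u, L.step u p ∉ B ∧ L.step u p ∈ tr) ∧ x = u ∧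
          ∃ r skip', L.IsRoute v r u ∧ r.length = d ∧ mem = .search d false (back r) skip' ∧
            ∀ q, q ∈ skip' ↔ ∃ r' e, L.IsRoute v (r' ++ [e]) u ∧ (r' ++ [e]).length = d ∧
              Avoids skip (r' ++ [e]) ∧ e.2 = q)) := by
  rw [searchRound, Prog.run_bind, sweep_end ht]
  have key : ∀ r, r ∈ ((sweep test d (G.degree v) (decide (v ∈ B)) skip).run L B v).2.2 ↔
      L.IsRoute v r u ∧ r.length = d ∧ Avoids skip r := by
    intro r
    rw [mem_sweep_iff ht]
    constructor
    · rintro ⟨h1, h2, x, hx, h3, h4⟩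
      obtain rfl := huniq r x h1 h2 h3 hx h4
      exact ⟨h3, h1, h2⟩
    · rintro ⟨h1, h2, h3⟩
      exact ⟨h2, h3, u, hu, h1, hN⟩
  cases h : ((sweep test d (G.degree v) (decide (v ∈ B)) skip).run L B v).2.2 with
  | nil => exact absurd ((key r₀).2 ⟨hr₀, hd, hs⟩) (by simp [h])
  | cons r rs =>
    rw [h] at key
    obtain ⟨hr, hrd, -⟩ := (key r).1 (by simp)
    obtain ⟨tr, x, mem, h1, h2⟩ := advance_run (B := B) d (back r) rs hr
    refine ⟨_ ++ tr, x, mem, by simp only [h1]; rfl, ?_⟩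
    rcases h2 with h2 | ⟨h2, h3, h4⟩
    · exact Or.inl h2
    · refine Or.inr ⟨fun p hp => ⟨(h2 p hp).1, List.mem_append_right _ (h2 p hp).2⟩, h3, r, _, hr,
        hrd, h4, fun q => ?_⟩
      simp only [List.mem_filterMap, key, Option.map_eq_some_iff]
      constructor
      · rintro ⟨r', ⟨h5, h6, h7⟩, e, he, rfl⟩
        obtain ⟨r', rfl⟩ := List.getLast?_eq_some_iff.1 he
        exact ⟨r', e, h5, h6, h7, rfl⟩
      · rintro ⟨r', e, h5, h6, h7, rfl⟩
        exact ⟨r' ++ [e], ⟨h5, h6, h7⟩, e, by simp, rfl⟩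

theorem isNew_inPlace {Δ : ℕ} (hΔ : ∀ v, G.degree v ≤ Δ) (am : Bool) (back : List ℕ) :
    InPlace L B (isNew am back) (2 * Δ + 2 * back.length) := by
  intro u hu
  obtain ⟨tr, b, h1, h2⟩ := isNew_run (L := L) hΔ am back hu
  simp [h1, h2]

theorem isNew_of_adj (am : Bool) (back : List ℕ) {u : V}
    (h : ∃ p < G.degree u, L.step u p ∈ B) :
    ((isNew am back (G.degree u)).run L B u).2.2 = !am := by
  obtain ⟨tr, o, h1, -, h3, h4⟩ :=
    scan_run (L := L) (B := B) u (List.range (G.degree u)) (by simp)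
  cases o with
  | some p => simp [isNew, h1]
  | none =>
    obtain ⟨p, hp, hB⟩ := h
    exact absurd hB (h4 rfl p (by simpa using hp)).1

theorem isNew_iff_of_forall_not (am : Bool) (back : List ℕ) {u : V} (hu : u ∈ B)
    (h : ∀ p < G.degree u, L.step u p ∉ B) :
    ((isNew am back (G.degree u)).run L B u).2.2 = true ↔ ¬ L.Leads B u back := by
  obtain ⟨tr, o, h1, -, h3, h4⟩ :=
    scan_run (L := L) (B := B) u (List.range (G.degree u)) (by simp)
  cases o with
  | some p => exact absurd (h3 p rfl).2 (h p (by simpa using (h3 p rfl).1))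
  | none =>
    obtain ⟨tr', b, h1', -, h3'⟩ := leadsToMarker_run (L := L) (B := B) u back
    simp only [hu, decide_true] at h1'
    simp [isNew, h1, h1', ← h3']

end Execution

section Execution

variable {V : Type*} {G : SimpleGraph V} [G.LocallyFinite] {L : PortLabelling G} {B : Finset V}

/-! ### Levels along a shortest path -/

/-- The geometry of the hunt: `f` is the distance from the start, `w 0, …, w D` a shortest path to
the treasure, and the nodes with pebbles lie on it, before the treasure. -/
structure Trail (L : PortLabelling G) (B : Finset V) (f : V → ℕ) (w : ℕ → V) (D : ℕ) : Prop where
  step_le : ∀ v, ∀ p < G.degree v, f (L.step v p) ≤ f v + 1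
  le_step : ∀ v, ∀ p < G.degree v, f v ≤ f (L.step v p) + 1
  level : ∀ j ≤ D, f (w j) = j
  next : ∀ j < D, ∃ p < G.degree (w j), L.step (w j) p = w (j + 1)
  lt_of_mem : ∀ u ∈ B, f u < D
  eq_of_mem : ∀ u ∈ B, u = w (f u)

namespace Trail

variable {f : V → ℕ} {w : ℕ → V} {D : ℕ}

theorem route_le (T : Trail L B f w D) {v u : V} {r : Route} (h : L.IsRoute v r u) :
    f u ≤ f v + r.length ∧ f v ≤ f u + r.length := by
  induction r generalizing v with
  | nil => obtain rfl : v = u := h; simp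
  | cons e r ih =>
    have := ih h.2.2
    have h1 := T.step_le v e.1 h.1
    have h2 := T.le_step v e.1 h.1
    rw [List.length_cons]
    omega

/-- That the first step goes up shows later that this route avoids the barred ports, all of which go
down. -/
theorem exists_route (T : Trail L B f w D) (a n : ℕ) (h : a + n ≤ D) :
    ∃ r, L.IsRoute (w a) r (w (a + n)) ∧ r.length = n ∧
      ∀ e ∈ r.head?, f (L.step (w a) e.1) = a + 1 := by
  induction n generalizing a with
  | zero => exact ⟨[], rfl, rfl, by simp⟩
  | succ n ih =>
    obtain ⟨p, hp, hw⟩ := T.next a (by omega)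
    obtain ⟨r, h1, h2, -⟩ := ih (a + 1) (by omega)
    refine ⟨(p, L.inPort (w a) p) :: r, ⟨hp, rfl, ?_⟩, by simp [h2], ?_⟩
    · rw [show a + (n + 1) = a + 1 + n by omega]
      exact hw.symm ▸ h1
    · simp [hw, T.level (a + 1) (by omega)]

/-- Only `ps.length - 1` edges precede the edge of the marker, so one end of that edge is at most
this many levels away. -/
theorem exists_of_leads (T : Trail L B f w D) {v : V} {ps : List ℕ} (h : L.Leads B v ps) :
    ∃ x, ∃ p < G.degree x, x ∈ B ∧ L.step x p ∈ B ∧ f v + 1 ≤ f x + ps.length ∧ f x + 1 ≤ f v + ps.length := by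
  induction ps generalizing v with
  | nil => exact h.elim
  | cons p ps ih =>
    obtain ⟨hp, h⟩ := h
    have h1 := T.step_le v p hp
    have h2 := T.le_step v p hp
    split_ifs at h with hps
    · exact ⟨v, p, hp, h.1, h.2, by simp⟩
    · obtain ⟨x, q, hq, h3, h4, h5, h6⟩ := ih h
      refine ⟨x, q, hq, h3, h4, ?_⟩
      rw [List.length_cons]
      omega

/-- Neighbours lie on the three levels around `f v`, and each level contains at most one pebble. -/
theorem countP_le [DecidableEq V] (T : Trail L B f w D) (v : V) :
    ((List.range (G.degree v)).countP fun p => L.step v p ∈ B) ≤ 3 := by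
  have h1 : ((List.range (G.degree v)).countP fun p => decide (L.step v p ∈ B)) =
      ((Finset.range (G.degree v)).filter fun p => L.step v p ∈ B).card := by
    rw [List.countP_eq_length_filter]; rfl
  rw [h1, ← Finset.card_image_of_injOn (f := L.step v)]
  · refine le_trans (Finset.card_le_card (t := {w (f v - 1), w (f v), w (f v + 1)}) ?_)
      Finset.card_le_three
    intro u hu
    simp only [Finset.mem_image, Finset.mem_filter, Finset.mem_range] at hu
    obtain ⟨p, ⟨hp, hB⟩, rfl⟩ := hu
    have h2 := T.step_le v p hp
    have h3 := T.le_step v p hp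
    have h4 := T.eq_of_mem _ hB
    rw [h4]
    simp only [Finset.mem_insert, Finset.mem_singleton]
    have : f (L.step v p) = f v - 1 ∨ f (L.step v p) = f v ∨ f (L.step v p) = f v + 1 := by omega
    rcases this with h | h | h <;> simp [h]
  · intro p hp q hq h
    simp at hp hq
    exact step_injOn v hp.1 hq.1 h

/-- The ports through which walks of length `n` from level `a` enter a node at level `a + n` lead
back to a lower level. -/
theorem step_lt_of_route (T : Trail L B f w D) {v u : V} {r : Route} {e : ℕ × ℕ}
    (h : L.IsRoute v (r ++ [e]) u) (hu : f u = f v + (r ++ [e]).length) :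
    f (L.step u e.2) < f u := by
  obtain ⟨y, h1, h2, h3, h4⟩ := h.exists_of_append
  obtain rfl : L.step y e.1 = u := h4
  rw [h3, step_inPort h2, hu]
  have := (T.route_le h1).1
  rw [List.length_append, List.length_singleton]
  omega

/-- The treasure is found by a search of length `l` from a node at distance at most `l`. -/
theorem exists_route_treasure (T : Trail L B f w D) {a l : ℕ} (h : a < D) (hl : D ≤ a + l)
    {skip : List ℕ} (hs : ∀ q ∈ skip, f (L.step (w a) q) < a) :
    ∃ r, L.IsRoute (w a) r (w D) ∧ r ≠ [] ∧ r.length ≤ l ∧ Avoids skip r := by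
  obtain ⟨r, h1, h2, h3⟩ := T.exists_route a (D - a) (by omega)
  refine ⟨r, by rwa [show a + (D - a) = D by omega] at h1, ?_, by omega, fun e he hq => ?_⟩
  · rintro rfl
    simp at h2
    omega
  · have := hs _ hq
    have := h3 e he
    omega

end Trail

end Execution

section Execution

variable {V : Type*} {G : SimpleGraph V} [G.LocallyFinite]
  {L : PortLabelling G} {B : Finset V} {f : V → ℕ} {w : ℕ → V} {D k l : ℕ}

/-! ### The course of the hunt -/

/-- A trail with the pebbles of the oracle: the marker `i` begins at position `i * (2 * l + 1) + l`,
and the single pebble `i` has the position `(i + 1) * (2 * l + 1)`. -/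
structure MarkedTrail (L : PortLabelling G) (B : Finset V) (f : V → ℕ) (w : ℕ → V) (D k l : ℕ) :
    Prop extends Trail L B f w D where
  first : ∀ i, 3 * i < k → i * (2 * l + 1) + l < D → w (i * (2 * l + 1) + l) ∈ B
  second : ∀ i, 3 * i + 1 < k → i * (2 * l + 1) + l + 1 < D → w (i * (2 * l + 1) + l + 1) ∈ B
  third : ∀ i, 3 * i + 2 < k → i * (2 * l + 1) + (2 * l + 1) < D →
    w (i * (2 * l + 1) + (2 * l + 1)) ∈ B
  exists_of_mem : ∀ u ∈ B, ∃ i, (3 * i < k ∧ f u = i * (2 * l + 1) + l) ∨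
    (3 * i + 1 < k ∧ f u = i * (2 * l + 1) + l + 1) ∨
    (3 * i + 2 < k ∧ f u = i * (2 * l + 1) + (2 * l + 1))
  pos : 0 < D
  one_le : 1 ≤ l
  two_le : 0 < k → 2 ≤ l
  le_of_eq_zero : ∀ i, k = 3 * i → D ≤ i * (2 * l + 1) + l
  le_of_eq_one : ∀ i, k = 3 * i + 1 → D ≤ i * (2 * l + 1) + l + l
  le_of_eq_two : ∀ i, k = 3 * i + 2 → D ≤ i * (2 * l + 1) + l + 1 + l

/-- Comparing the levels of pebbles of groups `i` and `j` involves the products `i * m` and `j * m`;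
in each of these cases they are related linearly, so that `omega` can decide. -/
theorem mul_cases (m i j : ℕ) : j = i ∨ (j + 1 = i ∧ j * m + m = i * m) ∨
    (j = i + 1 ∧ j * m = i * m + m) ∨ (j * m + 2 * m ≤ i * m) ∨ (i * m + 2 * m ≤ j * m) := by
  have key : ∀ a b, a + 2 ≤ b → a * m + 2 * m ≤ b * m := fun a b h => by
    rw [← add_mul]; exact Nat.mul_le_mul_right m h
  rcases lt_trichotomy j i with h | h | h
  · rcases Nat.lt_or_ge (j + 1) i with h' | h'
    · exact Or.inr (Or.inr (Or.inr (Or.inl (key _ _ h'))))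
    · obtain rfl : i = j + 1 := by omega
      exact Or.inr (Or.inl ⟨rfl, by ring⟩)
  · exact Or.inl h
  · rcases Nat.lt_or_ge (i + 1) j with h' | h'
    · exact Or.inr (Or.inr (Or.inr (Or.inr (key _ _ h'))))
    · obtain rfl : j = i + 1 := by omega
      exact Or.inr (Or.inr (Or.inl ⟨rfl, by ring⟩))

/-- The agent is at the second node of marker `i`. -/
def AtMarker (L : PortLabelling G) (B : Finset V) (f : V → ℕ) (w : ℕ → V) (k l i : ℕ) (v : V)
    (mem : Mem) : Prop :=
  3 * i + 1 < k ∧ f v = i * (2 * l + 1) + l + 1 ∧ v ∈ B ∧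
    ∃ q < G.degree v, L.step v q = w (i * (2 * l + 1) + l) ∧ L.step v q ∈ B ∧
      mem = .search l true [q] []

/-- The agent is at the single pebble `i`. -/
def AtSingle (L : PortLabelling G) (B : Finset V) (f : V → ℕ) (w : ℕ → V) (k l i : ℕ) (v : V)
    (mem : Mem) : Prop :=
  3 * i + 2 < k ∧ f v = i * (2 * l + 1) + (2 * l + 1) ∧ v ∈ B ∧
    ∃ back skip, mem = .search l false back skip ∧ L.Leads B v back ∧ back.length = l + 1 ∧
      (∀ q ∈ skip, f (L.step v q) < f v) ∧
      ∀ r, L.IsRoute v r (w (i * (2 * l + 1) + l + 1)) → r.length = l → ¬ Avoids skip r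

/-- The agent is at the last pebble, which begins marker `i` but has no second node beside it. -/
def AtLast (L : PortLabelling G) (B : Finset V) (f : V → ℕ) (k l i : ℕ) (v : V)
    (mem : Mem) : Prop :=
  k = 3 * i + 1 ∧ f v = i * (2 * l + 1) + l ∧ v ∈ B ∧
    ∃ back skip, mem = .search l false back skip ∧ back.length ≤ 2 * l + 1 ∧
      ∀ q ∈ skip, f (L.step v q) < f v

namespace MarkedTrail

/-- The lowest possible level of a pebble is `l`, which is positive. The agent's start rounds
presuppose an unpebbled start. -/
theorem start_notMem (T : MarkedTrail L B f w D k l) : w 0 ∉ B := fun h => by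
  have hf0 : f (w 0) = 0 := T.level 0 (Nat.zero_le _)
  have hl := T.one_le
  obtain ⟨j, h9⟩ := T.exists_of_mem _ h
  omega

/-- Two pebbles at the same level are the same node, and there are no loops. -/
theorem ne_step (T : MarkedTrail L B f w D k l) {v : V} {p : ℕ} (hp : p < G.degree v) (hv : v ∈ B)
    (hB : L.step v p ∈ B) : f (L.step v p) ≠ f v := by
  intro h
  have h1 := T.eq_of_mem _ hv
  have h2 := T.eq_of_mem _ hB
  rw [h, ← h1] at h2
  exact (step_adj (L := L) hp).ne h2.symm

/-- The nearest other pebbles are `l` levels away, and `2 ≤ l` once there is a pebble. For `l = 1` a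
single pebble could pass for part of a marker. -/
theorem single_isolated (T : MarkedTrail L B f w D k l) {u : V} {i : ℕ} (hu : u ∈ B)
    (hf : f u = i * (2 * l + 1) + (2 * l + 1)) {p : ℕ} (hp : p < G.degree u) : L.step u p ∉ B := by
  intro hB
  have h1 := T.ne_step hp hu hB
  have h2 := T.step_le u p hp
  have h3 := T.le_step u p hp
  obtain ⟨j, h4⟩ := T.exists_of_mem _ hB
  have h5 := T.two_le (by omega)
  rcases mul_cases (2 * l + 1) i j with rfl | h | h | h | h <;> omega

theorem second_of_step (T : MarkedTrail L B f w D k l) {u : V} {i : ℕ} (hu : u ∈ B)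
    (hf : f u = i * (2 * l + 1) + l) {p : ℕ} (hp : p < G.degree u) (hB : L.step u p ∈ B) :
    3 * i + 1 < k ∧ f (L.step u p) = i * (2 * l + 1) + l + 1 := by
  have h1 := T.ne_step hp hu hB
  have h2 := T.step_le u p hp
  have h3 := T.le_step u p hp
  obtain ⟨j, h4⟩ := T.exists_of_mem _ hB
  have h5 := T.two_le (by omega)
  rcases mul_cases (2 * l + 1) i j with rfl | h | h | h | h <;> omega

/-- The state after moving to the first node of marker `i`. -/
theorem marker_or_last (T : MarkedTrail L B f w D k l) {i : ℕ} (hi : 3 * i < k) {v u x : V}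
    {mem : Mem} {tr : List V} {skip : List ℕ} {back : Route → List ℕ} (hu : u ∈ B) (hf : f u = i * (2 * l + 1) + l)
    (hv : f u = f v + l) (hback : ∀ r, r.length = l → (back r).length ≤ 2 * l + 1)
    (h : (∃ p < G.degree u, L.step u p ∈ B ∧ x = L.step u p ∧
          mem = .search l true [L.inPort u p] []) ∨
        ((∀ p < G.degree u, L.step u p ∉ B ∧ L.step u p ∈ tr) ∧ x = u ∧
          ∃ r skip', L.IsRoute v r u ∧ r.length = l ∧
            mem = .search l false (back r) skip' ∧
            ∀ q, q ∈ skip' ↔ ∃ r' e, L.IsRoute v (r' ++ [e]) u ∧ (r' ++ [e]).length = l ∧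
              Avoids skip (r' ++ [e]) ∧ e.2 = q)) :
    w D ∈ tr ∨ AtMarker L B f w k l i x mem ∨ AtLast L B f k l i x mem := by
  have hlt := T.lt_of_mem u hu
  have huw : u = w (i * (2 * l + 1) + l) := by rw [← hf]; exact T.eq_of_mem u hu
  rcases h with ⟨p, hp, hB, rfl, rfl⟩ | ⟨h1, rfl, r, skip', h2, h3, rfl, h4⟩
  · obtain ⟨h1, h2⟩ := T.second_of_step hu hf hp hB
    refine Or.inr (Or.inl ⟨h1, h2, hB, L.inPort u p, inPort_lt hp, ?_, ?_, rfl⟩)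
    · rw [step_inPort hp, huw]
    · rwa [step_inPort hp]
  · obtain ⟨p, hp, hw⟩ := T.next _ hlt
    rw [← T.eq_of_mem _ hu] at hp hw
    have h5 := h1 p hp
    rw [hw, hf] at h5
    by_cases hk : k = 3 * i + 1
    · refine Or.inr (Or.inr ⟨hk, hf, hu, _, _, rfl, ?_, fun q hq => ?_⟩)
      · exact hback r h3
      · obtain ⟨r', e, h6, h7, -, rfl⟩ := (h4 q).1 hq
        exact T.step_lt_of_route h6 (by rw [h7, hv])
    -- A further pebble was due here but is missing, so its position is not before the treasure. The
    -- treasure is therefore the next node of the path and was visited while the neighbours were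
    -- inspected.
    · left
      by_cases hD : i * (2 * l + 1) + l + 1 < D
      · exact absurd (T.second i (by omega) hD) h5.1
      · rw [show D = i * (2 * l + 1) + l + 1 by omega]
        exact h5.2

end MarkedTrail

/-! ### The rounds from each kind of search node -/

variable [DecidableEq V]

/-- Rounds from `s` and from a pebble become instances of `searchRound`, so that `searchRound_run`
serves both. -/
theorem huntRound_search (l : ℕ) (am : Bool) (back skip : List ℕ) {v : V} (hv : v ∈ B) :
    huntRound (.search l am back skip) (G.degree v) =
      searchRound (isNew am back) l (decide (v ∈ B)) skip (fun r => (r.map Prod.snd).reverse ++ back)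
        (.search l am back skip) (G.degree v) := by
  simp only [hv, decide_true]; rfl

theorem huntRound_start (d : ℕ) {v : V} (hv : v ∉ B) :
    huntRound (.start d) (G.degree v) =
      searchRound (fun _ => pure true) d (decide (v ∈ B)) [] (fun _ => []) (.start (d + 1))
        (G.degree v) := by
  simp only [hv, decide_false]; rfl

namespace MarkedTrail

/-- From a marker the agent moves on to the next single pebble, or meets the treasure. -/
theorem marker_round (T : MarkedTrail L B f w D k l) {Δ : ℕ} (hΔ : ∀ v, G.degree v ≤ Δ) {i : ℕ}
    {v : V} {mem : Mem} (h : AtMarker L B f w k l i v mem) :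
    w D ∈ ((huntRound mem (G.degree v)).run L B v).1 ∨
      AtSingle L B f w k l i ((huntRound mem (G.degree v)).run L B v).2.1
        ((huntRound mem (G.degree v)).run L B v).2.2 := by
  obtain ⟨hk, hfv, hv, q, hq, hqw, hqB, rfl⟩ := h
  have hvw : v = w (i * (2 * l + 1) + l + 1) := by rw [← hfv]; exact T.eq_of_mem v hv
  have hl := T.two_le (by omega)
  rw [huntRound_search l true [q] [] hv]
  have ht := isNew_inPlace (L := L) (B := B) hΔ true [q]
  by_cases hD : D ≤ i * (2 * l + 1) + l + 1 + l
  · left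
    obtain ⟨r, h1, h2, h3, h4⟩ := T.exists_route_treasure (skip := [])
      (hfv ▸ T.lt_of_mem v hv) hD (by simp)
    rw [← hvw] at h1
    exact mem_searchRound_trace ht h1 h2 h3 h4 _ _
  · right
    have hk2 : 3 * i + 2 < k := by
      by_contra hk2
      exact hD (T.le_of_eq_two i (by omega))
    have hu := T.third i hk2 (by omega)
    set u := w (i * (2 * l + 1) + (2 * l + 1)) with hudef
    have hfu : f u = i * (2 * l + 1) + (2 * l + 1) := T.level _ (by omega)
    have hiso : ∀ p < G.degree u, L.step u p ∉ B := fun p hp => T.single_isolated hu hfu hp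
    obtain ⟨r₀, hr₀, hr₀l, -⟩ := T.exists_route (i * (2 * l + 1) + l + 1) l (by omega)
    rw [show i * (2 * l + 1) + l + 1 + l = i * (2 * l + 1) + (2 * l + 1) by omega, ← hvw,
      ← hudef] at hr₀
    obtain ⟨tr, x, mem, h1, h2⟩ := searchRound_run (L := L) ht (skip := [])
      (fun r => (r.map Prod.snd).reverse ++ [q]) (.search l true [q] []) hu
      ((isNew_iff_of_forall_not _ _ hu hiso).2 fun hl => hiso q hl.1 hl.2.2) hr₀ hr₀l (by simp) (by
        intro r x hr _ hrx hx hN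
        have h3 := T.route_le hrx
        have h5 := T.eq_of_mem x hx
        -- A pebble with a pebbled neighbour is rejected since the search starts in a marker. This
        -- excludes both nodes of marker `i`, and the levels exclude everything else but the single
        -- pebble.
        by_cases hadj : ∃ p < G.degree x, L.step x p ∈ B
        · rw [isNew_of_adj _ _ hadj] at hN
          simp at hN
        · suffices h4 : f x = i * (2 * l + 1) + (2 * l + 1) by rw [h5, h4]
          have h6 : f x ≠ i * (2 * l + 1) + l + 1 := fun h => hadj
            ⟨q, by rw [h5, h, ← hvw]; exact ⟨hq, hqB⟩⟩
          have h7 : f x ≠ i * (2 * l + 1) + l := fun h => hadj (by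
            obtain ⟨p, hp, hpw⟩ := T.next (f x) (T.lt_of_mem x hx)
            rw [← h5, h, ← hvw] at hpw
            rw [← h5] at hp
            exact ⟨p, hp, hpw ▸ hv⟩)
          obtain ⟨j, h8⟩ := T.exists_of_mem _ hx
          rcases mul_cases (2 * l + 1) i j with rfl | h | h | h | h <;> omega)
    rw [h1]
    rcases h2 with ⟨p, hp, hB, -, -⟩ | ⟨-, rfl, r, skip', h3, h4, rfl, h5⟩
    · exact absurd hB (hiso p hp)
    · refine ⟨hk2, hfu, hu, _, _, rfl, ?_, by simp [h4], fun q' hq' => ?_, fun r' hr' hl' hs => ?_⟩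
      · exact Leads.reverse_append ⟨hq, by simp [hv, hqB]⟩ h3
      · obtain ⟨r', e, h6, h7, -, rfl⟩ := (h5 q').1 hq'
        exact T.step_lt_of_route h6 (by rw [h7, hfu]; omega)
      -- A walk of length `l` back to the marker is the reversal of a walk just searched, so its
      -- first port is the stored entry port of that walk.
      · obtain _ | ⟨e, r'⟩ := r'
        · simp at hl'; omega
        · rw [← hvw] at hr'
          have h6 := hr'.reverse
          rw [List.map_cons, List.reverse_cons] at h6
          simp only [avoids_cons] at hs
          exact hs ((h5 _).2 ⟨_, e.swap, h6, by simpa using hl', by simp, rfl⟩)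

/-- From a single pebble the agent moves on to the next marker, or meets the treasure. -/
theorem single_round (T : MarkedTrail L B f w D k l) {Δ : ℕ} (hΔ : ∀ v, G.degree v ≤ Δ) {i : ℕ}
    {v : V} {mem : Mem} (h : AtSingle L B f w k l i v mem) :
    w D ∈ ((huntRound mem (G.degree v)).run L B v).1 ∨
      AtMarker L B f w k l (i + 1) ((huntRound mem (G.degree v)).run L B v).2.1
        ((huntRound mem (G.degree v)).run L B v).2.2 ∨
      AtLast L B f k l (i + 1) ((huntRound mem (G.degree v)).run L B v).2.1
        ((huntRound mem (G.degree v)).run L B v).2.2 := by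
  obtain ⟨hk, hfv, hv, back, skip, rfl, hlead, hback, hskip, hret⟩ := h
  have hm : (i + 1) * (2 * l + 1) = i * (2 * l + 1) + (2 * l + 1) := by ring
  have hvw : v = w (i * (2 * l + 1) + (2 * l + 1)) := by rw [← hfv]; exact T.eq_of_mem v hv
  have hl := T.two_le (by omega)
  rw [huntRound_search l false back skip hv]
  have ht := isNew_inPlace (L := L) (B := B) hΔ false back
  by_cases hD : D ≤ i * (2 * l + 1) + (2 * l + 1) + l
  · left
    obtain ⟨r, h1, h2, h3, h4⟩ := T.exists_route_treasure (skip := skip)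
      (hfv ▸ T.lt_of_mem v hv) hD (by rwa [← hvw, ← hfv])
    rw [← hvw] at h1
    exact mem_searchRound_trace ht h1 h2 h3 h4 _ _
  · have hk2 : 3 * (i + 1) < k := by
      by_contra hk2
      exact hD (hm ▸ T.le_of_eq_zero (i + 1) (by omega))
    have hu := T.first (i + 1) hk2 (by omega)
    set u := w ((i + 1) * (2 * l + 1) + l) with hudef
    have hfu : f u = (i + 1) * (2 * l + 1) + l := T.level _ (by omega)
    obtain ⟨r₀, hr₀, hr₀l, hr₀s⟩ := T.exists_route (i * (2 * l + 1) + (2 * l + 1)) l (by omega)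
    rw [← hm, ← hudef] at hr₀
    rw [← hm] at hr₀s hfv hvw
    rw [← hvw] at hr₀ hr₀s
    have hiso : ∀ p < G.degree v, L.step v p ∉ B :=
      fun p hp => T.single_isolated hv (hfv.trans hm) hp
    have hN : ((isNew false back (G.degree u)).run L B u).2.2 = true := by
      by_cases hadj : ∃ p < G.degree u, L.step u p ∈ B
      · rw [isNew_of_adj _ _ hadj]; rfl
      · rw [isNew_iff_of_forall_not _ _ hu fun p hp hB => hadj ⟨p, hp, hB⟩]
        -- The return sequence has length `l + 1`, so a marker reached by it from `u` would have a
        -- node within `l` levels of `u`. The only candidates are the single pebble, `u` itself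
        -- (both without pebbled neighbours) and a node just above `u`, which the path would make a
        -- pebbled neighbour of `u`.
        intro hle
        obtain ⟨x, p, hp, hx, hB, h3, h4⟩ := T.exists_of_leads hle
        have h5 := T.eq_of_mem x hx
        have h6 : f x ≠ (i + 1) * (2 * l + 1) := fun h => by
          obtain rfl : x = v := by rw [h5, h, ← hvw]
          exact hiso p hp hB
        have h7 : f x ≠ (i + 1) * (2 * l + 1) + l := fun h => by
          obtain rfl : x = u := by rw [h5, h]
          exact hadj ⟨p, hp, hB⟩
        have h8 : f x ≠ (i + 1) * (2 * l + 1) + l + 1 := fun h => by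
          obtain ⟨p', hp', hpw⟩ := T.next (f u) (T.lt_of_mem u hu)
          rw [← T.eq_of_mem u hu] at hp' hpw
          rw [hfu, ← h, ← h5] at hpw
          exact hadj ⟨p', hp', hpw ▸ hx⟩
        obtain ⟨j, h9⟩ := T.exists_of_mem _ hx
        rcases mul_cases (2 * l + 1) i j with rfl | h | h | h | h <;> omega
    obtain ⟨tr, x, mem, h1, h2⟩ := searchRound_run (L := L) ht (skip := skip)
      (fun r => (r.map Prod.snd).reverse ++ back) (.search l false back skip) hu hN hr₀ hr₀l
      (fun e he hq => by
        have := hskip _ hq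
        have := hr₀s e he
        omega) (by
        intro r x hr hs hrx hx hN
        have h3 := T.route_le hrx
        have h5 := T.eq_of_mem x hx
        suffices h4 : f x = (i + 1) * (2 * l + 1) + l by rw [h5, h4]
        -- A closed walk back to the search node is rejected by its own return sequence; a walk down
        -- to the previous marker would have to start with a barred port.
        have h6 : f x ≠ (i + 1) * (2 * l + 1) := fun h => by
          obtain rfl : x = v := by rw [h5, h, ← hvw]
          exact (isNew_iff_of_forall_not _ _ hv hiso).1 hN hlead
        have h7 : f x ≠ i * (2 * l + 1) + l + 1 := fun h => by
          rw [h5, h] at hrx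
          exact hret r hrx hr hs
        obtain ⟨j, h9⟩ := T.exists_of_mem _ hx
        rcases mul_cases (2 * l + 1) i j with rfl | h | h | h | h <;> omega)
    rw [h1]
    exact T.marker_or_last hk2 hu hfu (by omega)
      (fun r hr => by simp [hr, hback]; omega) h2

/-- The search from the last pebble meets the treasure. -/
theorem last_round (T : MarkedTrail L B f w D k l) {Δ : ℕ} (hΔ : ∀ v, G.degree v ≤ Δ) {i : ℕ}
    {v : V} {mem : Mem} (h : AtLast L B f k l i v mem) :
    w D ∈ ((huntRound mem (G.degree v)).run L B v).1 := by
  obtain ⟨hk, hfv, hv, back, skip, rfl, hback, hskip⟩ := h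
  have hvw : v = w (i * (2 * l + 1) + l) := by rw [← hfv]; exact T.eq_of_mem v hv
  rw [huntRound_search l false back skip hv]
  obtain ⟨r, h1, h2, h3, h4⟩ := T.exists_route_treasure (skip := skip)
    (hfv ▸ T.lt_of_mem v hv) (T.le_of_eq_one i hk) (by rwa [← hvw, ← hfv])
  rw [← hvw] at h1
  exact mem_searchRound_trace (isNew_inPlace (L := L) (B := B) hΔ false back) h1 h2 h3 h4 _ _

/-- The last level searched from the start. -/
theorem start_round (T : MarkedTrail L B f w D k l) :
    w D ∈ ((huntRound (.start l) (G.degree (w 0))).run L B (w 0)).1 ∨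
      AtMarker L B f w k l 0 ((huntRound (.start l) (G.degree (w 0))).run L B (w 0)).2.1
        ((huntRound (.start l) (G.degree (w 0))).run L B (w 0)).2.2 ∨
      AtLast L B f k l 0 ((huntRound (.start l) (G.degree (w 0))).run L B (w 0)).2.1
        ((huntRound (.start l) (G.degree (w 0))).run L B (w 0)).2.2 := by
  have hf0 : f (w 0) = 0 := T.level 0 (Nat.zero_le _)
  have hl := T.one_le
  rw [huntRound_start l T.start_notMem]
  have ht : InPlace L B (fun _ => pure true) 0 := fun _ _ => ⟨rfl, le_rfl⟩
  by_cases hD : D ≤ l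
  · left
    obtain ⟨r, h1, h2, h3, h4⟩ := T.exists_route_treasure (a := 0) (l := l) (skip := [])
      T.pos (by omega) (by simp)
    exact mem_searchRound_trace ht h1 h2 h3 h4 _ _
  · have hk : 3 * 0 < k := by
      by_contra hk
      exact hD ((T.le_of_eq_zero 0 (by omega)).trans (by omega))
    have hu := T.first 0 hk (by omega)
    set u := w (0 * (2 * l + 1) + l) with hudef
    have hfu : f u = 0 * (2 * l + 1) + l := T.level _ (by omega)
    obtain ⟨r₀, hr₀, hr₀l, -⟩ := T.exists_route 0 l (by omega)
    rw [show 0 + l = 0 * (2 * l + 1) + l by omega, ← hudef] at hr₀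
    obtain ⟨tr, x, mem, h1, h2⟩ := searchRound_run (L := L) ht (skip := [])
      (fun _ => []) (.start (l + 1)) hu rfl hr₀ hr₀l (by simp) (by
        intro r x hr hs hrx hx _
        have h3 := T.route_le hrx
        have h5 := T.eq_of_mem x hx
        suffices h4 : f x = 0 * (2 * l + 1) + l by rw [h5, h4]
        obtain ⟨j, h9⟩ := T.exists_of_mem _ hx
        rcases mul_cases (2 * l + 1) 0 j with rfl | h | h | h | h <;> omega)
    rw [h1]
    exact T.marker_or_last (v := w 0) hk hu hfu (by omega) (by simp) h2

end MarkedTrail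

end Execution

section Execution

variable {V : Type*} [DecidableEq V] {G : SimpleGraph V} [G.LocallyFinite]
  {L : PortLabelling G} {B : Finset V} {f : V → ℕ} {w : ℕ → V} {D k l Δ : ℕ}

/-! ### The time of the hunt -/

/-- The time of travelling to a new pebble and inspecting its neighbours is of lower order. -/
theorem add_le_mul_pow (hl : 1 ≤ l) (h0 : 1 ≤ Δ) : l + 2 * Δ + 1 ≤ 4 * (l * Δ ^ l) := by
  have h1 : Δ ≤ Δ ^ l := Nat.le_self_pow (by omega) Δ
  nlinarith

theorem rounds_succ {s v : V} {n : ℕ} {c : List V} {mem : Mem}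
    (h : treasureHuntForGraphWithMarker.rounds L B s n = (c, v, mem)) :
    treasureHuntForGraphWithMarker.rounds L B s (n + 1) =
      (c ++ ((huntRound mem (G.degree v)).run L B v).1,
        ((huntRound mem (G.degree v)).run L B v).2) := by
  rw [Agent.rounds, h]
  rfl

namespace MarkedTrail

theorem search_length (T : MarkedTrail L B f w D k l) (hΔ : ∀ v, G.degree v ≤ Δ) (h0 : 1 ≤ Δ)
    (h2 : 2 ≤ Δ ∨ l = 1) {v : V} (hv : v ∈ B) (am : Bool) {back : List ℕ} (skip : List ℕ)
    (hback : back.length ≤ 2 * l + 1) :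
    ((huntRound (.search l am back skip) (G.degree v)).run L B v).1.length ≤
      32 * (l * Δ ^ l) := by
  rw [huntRound_search l am back skip hv]
  refine (searchRound_length (isNew_inPlace hΔ am back) hΔ T.countP_le l v skip _ _).trans ?_
  have hl := T.one_le
  have h3 := add_le_mul_pow hl h0
  obtain ⟨d, rfl⟩ : ∃ d, l = d + 1 := ⟨l - 1, by omega⟩
  have h4 := sweepCost_le (2 * Δ + 2 * back.length) d (h2.imp_right (by omega))
  -- With `l = d + 1` the bracket is at most `10 * Δ + 12 * l + 6`, hence at most `28 * Δ * l`.
  have h5 : Δ ^ d * (4 * Δ + 3 * (2 * Δ + 2 * back.length)) ≤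
      Δ ^ d * (Δ * (28 * (d + 1))) := Nat.mul_le_mul_left _ (by nlinarith)
  have h6 : Δ ^ d * (Δ * (28 * (d + 1))) = 28 * ((d + 1) * Δ ^ (d + 1)) := by ring
  omega

theorem start_length (T : MarkedTrail L B f w D k l) (hΔ : ∀ v, G.degree v ≤ Δ) (h0 : 1 ≤ Δ)
    (h2 : 2 ≤ Δ ∨ l = 1) :
    ((huntRound (.start l) (G.degree (w 0))).run L B (w 0)).1.length ≤ 8 * (l * Δ ^ l) := by
  rw [huntRound_start l T.start_notMem]
  have ht : InPlace L B (fun _ => pure true) 0 := fun _ _ => ⟨rfl, le_rfl⟩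
  refine (searchRound_length ht hΔ T.countP_le l (w 0) [] _ _).trans ?_
  have hl := T.one_le
  have h3 := add_le_mul_pow hl h0
  obtain ⟨d, rfl⟩ : ∃ d, l = d + 1 := ⟨l - 1, by omega⟩
  have h4 := sweepCost_le 0 d (h2.imp_right (by omega))
  have h5 : Δ ^ d * (4 * Δ + 3 * 0) = 4 * Δ ^ (d + 1) := by ring
  have h6 : Δ ^ (d + 1) ≤ (d + 1) * Δ ^ (d + 1) := Nat.le_mul_of_pos_left _ hl
  omega

/-- The levels before the first pebble. -/
theorem start_rounds (T : MarkedTrail L B f w D k l) (hΔ : ∀ v, G.degree v ≤ Δ)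
    (h2 : 2 ≤ Δ ∨ l = 1) (d : ℕ) (hd : d < l) :
    ∃ c, treasureHuntForGraphWithMarker.rounds L B (w 0) d = (c, w 0, .start (d + 1)) ∧
      c.length ≤ 1 + 8 * Δ ^ d := by
  induction d with
  | zero => exact ⟨[w 0], rfl, by simp⟩
  | succ d ih =>
    obtain ⟨c, h3, h4⟩ := ih (by omega)
    have ht : InPlace L B (fun _ => pure true) 0 := fun _ _ => ⟨rfl, le_rfl⟩
    obtain ⟨h5, h6⟩ := searchRound_eq_of_forall_not (L := L) (v := w 0) (skip := []) ht
      (fun _ => []) (.start (d + 1 + 1)) (d := d + 1) (by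
        intro r u hr hru hu
        have h7 := T.route_le hru
        have h8 : f (w 0) = 0 := T.level 0 (Nat.zero_le _)
        obtain ⟨j, h9⟩ := T.exists_of_mem _ hu
        omega)
    rw [← huntRound_start (d + 1) T.start_notMem] at h5 h6
    refine ⟨_, (rounds_succ h3).trans (Prod.ext rfl h5), ?_⟩
    rw [List.length_append, h6]
    have h7 := sweep_length ht hΔ T.countP_le (d + 1) (w 0) []
    have h8 := sweepCost_le 0 d (h2.imp_right (by omega))
    have h9 : Δ ^ d * (4 * Δ + 3 * 0) = 4 * Δ ^ (d + 1) := by ring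
    -- The costs of the levels form a geometric sum. Here `l` exceeds 1, so `2 ≤ Δ` is available.
    have h10 : Δ ^ d * 2 ≤ Δ ^ (d + 1) := by
      rw [pow_succ]
      exact Nat.mul_le_mul_left _ (by omega)
    omega

/-- The progress of the agent: marker by marker. -/
theorem rounds_marker (T : MarkedTrail L B f w D k l) (hΔ : ∀ v, G.degree v ≤ Δ) (h0 : 1 ≤ Δ)
    (h2 : 2 ≤ Δ ∨ l = 1) (i : ℕ) :
    ∃ n c v mem, treasureHuntForGraphWithMarker.rounds L B (w 0) n = (c, v, mem) ∧
      c.length ≤ 1 + (16 + 64 * i) * (l * Δ ^ l) ∧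
      (w D ∈ c ∨ AtMarker L B f w k l i v mem ∨ AtLast L B f k l i v mem) := by
  induction i with
  | zero =>
    have hl := T.one_le
    obtain ⟨c, h3, h4⟩ := T.start_rounds hΔ h2 (l - 1) (by omega)
    rw [show l - 1 + 1 = l by omega] at h3
    refine ⟨_, _, _, _, rounds_succ h3, ?_, ?_⟩
    -- The 16 consists of 8 for the levels below `l` and 8 for level `l`; the extra 1 counts the
    -- start node in the list.
    · have h5 := T.start_length hΔ h0 h2
      have h6 : Δ ^ (l - 1) ≤ Δ ^ l := Nat.pow_le_pow_right h0 (by omega)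
      have h7 : Δ ^ l ≤ l * Δ ^ l := Nat.le_mul_of_pos_left _ hl
      rw [List.length_append]
      omega
    · rcases T.start_round with h | h
      · exact Or.inl (List.mem_append_right _ h)
      · exact Or.inr h
  | succ i ih =>
    obtain ⟨n, c, v, mem, h3, h4, h5⟩ := ih
    have h6 : (16 + 64 * (i + 1)) * (l * Δ ^ l) =
      (16 + 64 * i) * (l * Δ ^ l) + 64 * (l * Δ ^ l) := by ring
    rcases h5 with h5 | h5 | h5
    · exact ⟨n, c, v, mem, h3, by omega, Or.inl h5⟩
    · have h7 : ((huntRound mem (G.degree v)).run L B v).1.length ≤ 32 * (l * Δ ^ l) := by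
        obtain ⟨-, -, hv, q, -, -, -, rfl⟩ := h5
        exact T.search_length hΔ h0 h2 hv _ _ (by simp)
      rcases T.marker_round hΔ h5 with h8 | h8
      · refine ⟨n + 1, _, _, _, rounds_succ h3, ?_, Or.inl (List.mem_append_right _ h8)⟩
        rw [List.length_append]
        omega
      · have h3' := rounds_succ h3
        generalize (huntRound mem (G.degree v)).run L B v = R at *
        obtain ⟨c', v', mem'⟩ := R
        have h9 : ((huntRound mem' (G.degree v')).run L B v').1.length ≤ 32 * (l * Δ ^ l) := by
          obtain ⟨-, -, hv, back, skip, rfl, -, hb, -⟩ := h8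
          exact T.search_length hΔ h0 h2 hv _ _ (by omega)
        refine ⟨n + 1 + 1, _, _, _, rounds_succ h3', ?_, ?_⟩
        · rw [List.length_append, List.length_append]
          simp only at h7 ⊢
          omega
        · rcases T.single_round hΔ h8 with h | h
          · exact Or.inl (List.mem_append_right _ h)
          · exact Or.inr h
    · have h7 : ((huntRound mem (G.degree v)).run L B v).1.length ≤ 32 * (l * Δ ^ l) := by
        obtain ⟨-, -, hv, back, skip, rfl, hb, -⟩ := h5
        exact T.search_length hΔ h0 h2 hv _ _ hb
      refine ⟨n + 1, _, _, _, rounds_succ h3, ?_, Or.inl (List.mem_append_right _ (T.last_round hΔ h5))⟩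
      rw [List.length_append]
      omega

theorem exists_visitsAt (T : MarkedTrail L B f w D k l) (hΔ : ∀ v, G.degree v ≤ Δ) (h0 : 1 ≤ Δ)
    (h2 : 2 ≤ Δ ∨ l = 1) :
    ∃ t, treasureHuntForGraphWithMarker.VisitsAt L B (w 0) (w D) t ∧
      t ≤ 80 * ((2 * (k / 3) + 1) * l * Δ ^ l) := by
  -- There is no marker with the index `k / 3 + 1`, so only the alternative that the treasure has
  -- been met survives.
  obtain ⟨n, c, v, mem, h3, h4, h5⟩ := T.rounds_marker hΔ h0 h2 (k / 3 + 1)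
  have h6 : w D ∈ c := by
    rcases h5 with h5 | h5 | h5
    · exact h5
    · have := h5.1
      omega
    · have := h5.1
      omega
  obtain ⟨t, ht⟩ := List.mem_iff_getElem?.1 h6
  refine ⟨t, ⟨n, by rw [h3]; exact ht⟩, ?_⟩
  obtain ⟨ht', -⟩ := List.getElem?_eq_some_iff.1 ht
  have h7 : (16 + 64 * (k / 3 + 1)) * (l * Δ ^ l) ≤ (80 * (2 * (k / 3) + 1)) * (l * Δ ^ l) :=
    Nat.mul_le_mul_right _ (by omega)
  have h8 : 80 * ((2 * (k / 3) + 1) * l * Δ ^ l) = (80 * (2 * (k / 3) + 1)) * (l * Δ ^ l) := by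
    ring
  omega

end MarkedTrail

end Execution

/-! ### The placement of the pebbles -/

/-- The three conditions by residue say that the treasure is at most `l` beyond the last intended
pebble (or beyond `s` if `k = 0`); they follow from rounding up. Rounding costs less than one
divisor, whence the last bound. -/
theorem spacing_bounds {k D : ℕ} (h : 2 * k < D) :
    1 ≤ spacing k D ∧ (0 < k → 2 ≤ spacing k D) ∧
    (∀ i, k = 3 * i → D ≤ i * (2 * spacing k D + 1) + spacing k D) ∧
    (∀ i, k = 3 * i + 1 → D ≤ i * (2 * spacing k D + 1) + spacing k D + spacing k D) ∧
    (∀ i, k = 3 * i + 2 → D ≤ i * (2 * spacing k D + 1) + spacing k D + 1 + spacing k D) ∧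
    (2 * (k / 3) + 1) * spacing k D ≤ D + k / 3 + 1 := by
  have key : ∀ a b, 0 < b → a ≤ b * (a ⌈/⌉ b) ∧ b * (a ⌈/⌉ b) < a + b := by
    intro a b hb
    rw [Nat.ceilDiv_eq_add_pred_div]
    have h1 := Nat.div_add_mod (a + b - 1) b
    have h2 := Nat.mod_lt (a + b - 1) hb
    omega
  obtain ⟨η, hη⟩ : ∃ η, k / 3 = η := ⟨_, rfl⟩
  -- All products are expressed through the single term `η * l`, which makes the remaining goals
  -- linear.
  have hi : ∀ i, i = η → ∀ l, i * (2 * l + 1) = 2 * (η * l) + η := by rintro i rfl l; ring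
  have hk : k % 3 = 0 ∨ k % 3 = 1 ∨ k % 3 = 2 := by omega
  rw [spacing, hη]
  rcases hk with hk | hk | hk
  · rw [if_pos hk]
    obtain ⟨h1, h2⟩ := key (D - η) (2 * η + 1) (by omega)
    generalize (D - η) ⌈/⌉ (2 * η + 1) = l at *
    have h3 : (2 * η + 1) * l = 2 * (η * l) + l := by ring
    refine ⟨?_, fun _ => ?_, fun i h => ?_, fun i h => ?_, fun i h => ?_, ?_⟩
    · by_contra h; obtain rfl : l = 0 := by omega
      omega
    · by_contra h; obtain rfl | rfl : l = 0 ∨ l = 1 := by omega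
      all_goals omega
    all_goals try rw [hi i (by omega)]
    all_goals omega
  · rw [if_neg (by omega), if_pos hk]
    obtain ⟨h1, h2⟩ := key (D - η) (2 * η + 2) (by omega)
    generalize (D - η) ⌈/⌉ (2 * η + 2) = l at *
    have h3 : (2 * η + 1) * l = 2 * (η * l) + l := by ring
    have h4 : (2 * η + 2) * l = 2 * (η * l) + 2 * l := by ring
    refine ⟨?_, fun _ => ?_, fun i h => ?_, fun i h => ?_, fun i h => ?_, ?_⟩
    · by_contra h; obtain rfl : l = 0 := by omega
      omega
    · by_contra h; obtain rfl | rfl : l = 0 ∨ l = 1 := by omega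
      all_goals omega
    all_goals try rw [hi i (by omega)]
    all_goals omega
  · rw [if_neg (by omega), if_neg (by omega)]
    obtain ⟨h1, h2⟩ := key (D - η - 1) (2 * η + 2) (by omega)
    generalize (D - η - 1) ⌈/⌉ (2 * η + 2) = l at *
    have h3 : (2 * η + 1) * l = 2 * (η * l) + l := by ring
    have h4 : (2 * η + 2) * l = 2 * (η * l) + 2 * l := by ring
    refine ⟨?_, fun _ => ?_, fun i h => ?_, fun i h => ?_, fun i h => ?_, ?_⟩
    · by_contra h; obtain rfl : l = 0 := by omega
      omega
    · by_contra h; obtain rfl | rfl : l = 0 ∨ l = 1 := by omega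
      all_goals omega
    all_goals try rw [hi i (by omega)]
    all_goals omega

theorem dist_getVert_of_length_eq_dist {V : Type*} {G : SimpleGraph V} (hG : G.Connected) {s t : V}
    {P : G.Walk s t} (hP : P.length = G.dist s t) {j : ℕ} (hj : j ≤ P.length) :
    G.dist s (P.getVert j) = j := by
  have h1 := SimpleGraph.dist_le (P.take j)
  have h2 := SimpleGraph.dist_le (P.drop j)
  have h3 := hG.dist_triangle (u := s) (v := P.getVert j) (w := t)
  rw [SimpleGraph.Walk.take_length] at h1
  rw [SimpleGraph.Walk.drop_length] at h2
  omega

theorem mem_markerPlacement {V : Type*} [DecidableEq V] {G : SimpleGraph V} {s t : V}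
    {P : G.Walk s t} {k : ℕ} {u : V} :
    u ∈ markerPlacement P k ↔ ∃ j < k, pebblePos (spacing k P.length) j < P.length ∧
      P.getVert (pebblePos (spacing k P.length) j) = u := by
  simp only [markerPlacement, Finset.mem_image, Finset.mem_filter, Finset.mem_range]
  constructor
  · rintro ⟨_, ⟨⟨j, hj, rfl⟩, h⟩, rfl⟩
    exact ⟨j, hj, h, rfl⟩
  · rintro ⟨j, hj, h, rfl⟩
    exact ⟨_, ⟨⟨j, hj, rfl⟩, h⟩, rfl⟩

theorem card_markerPlacement_le {V : Type*} [DecidableEq V] {G : SimpleGraph V} {s t : V}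
    (P : G.Walk s t) (k : ℕ) : (markerPlacement P k).card ≤ k :=
  Finset.card_image_le.trans <| (Finset.card_filter_le _ _).trans <|
    Finset.card_image_le.trans (Finset.card_range k).le

theorem pebblePos_first (l i : ℕ) : pebblePos l (3 * i) = i * (2 * l + 1) + l := by
  simp [pebblePos]

theorem pebblePos_second (l i : ℕ) : pebblePos l (3 * i + 1) = i * (2 * l + 1) + l + 1 := by
  rw [pebblePos, if_neg (by omega), if_pos (by omega), show (3 * i + 1) / 3 = i by omega]

theorem pebblePos_third (l i : ℕ) :
    pebblePos l (3 * i + 2) = i * (2 * l + 1) + (2 * l + 1) := by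
  rw [pebblePos, if_neg (by omega), if_neg (by omega), show (3 * i + 2) / 3 = i by omega]
  ring

theorem markedTrail_markerPlacement {V : Type*} [DecidableEq V] {G : SimpleGraph V}
    [G.LocallyFinite] (L : PortLabelling G) (hG : G.Connected) {s t : V} {P : G.Walk s t}
    (hP : P.length = G.dist s t) {k : ℕ} (hk : 2 * k < P.length) :
    MarkedTrail L (markerPlacement P k) (G.dist s) P.getVert P.length k (spacing k P.length) := by
  obtain ⟨h1, h2, h3, h4, h5, -⟩ := spacing_bounds hk
  have hlev : ∀ j ≤ P.length, G.dist s (P.getVert j) = j :=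
    fun j => dist_getVert_of_length_eq_dist hG hP
  refine ⟨⟨fun v p hp => ?_, fun v p hp => ?_, hlev, fun j hj => ?_, fun u hu => ?_,
    fun u hu => ?_⟩, fun i hi hD => ?_, fun i hi hD => ?_, fun i hi hD => ?_, fun u hu => ?_,
    by omega, h1, h2, h3, h4, h5⟩
  · have := hG.dist_triangle (u := s) (v := v) (w := L.step v p)
    rwa [SimpleGraph.dist_eq_one_iff_adj.2 (PortLabelling.step_adj hp)] at this
  · have := hG.dist_triangle (u := s) (v := L.step v p) (w := v)
    rwa [SimpleGraph.dist_eq_one_iff_adj.2 (PortLabelling.step_adj hp).symm] at this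
  · exact PortLabelling.exists_step (P.adj_getVert_succ hj)
  · obtain ⟨j, -, hj, rfl⟩ := mem_markerPlacement.1 hu
    rwa [hlev _ hj.le]
  · obtain ⟨j, -, hj, rfl⟩ := mem_markerPlacement.1 hu
    rw [hlev _ hj.le]
  · exact mem_markerPlacement.2 ⟨3 * i, hi, by rw [pebblePos_first]; exact ⟨hD, rfl⟩⟩
  · exact mem_markerPlacement.2 ⟨3 * i + 1, hi, by rw [pebblePos_second]; exact ⟨hD, rfl⟩⟩
  · exact mem_markerPlacement.2 ⟨3 * i + 2, hi, by rw [pebblePos_third]; exact ⟨hD, rfl⟩⟩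
  · obtain ⟨j, hjk, hj, rfl⟩ := mem_markerPlacement.1 hu
    rw [hlev _ hj.le]
    obtain ⟨i, rfl | rfl | rfl⟩ : ∃ i, j = 3 * i ∨ j = 3 * i + 1 ∨ j = 3 * i + 2 :=
      ⟨j / 3, by omega⟩
    · exact ⟨i, Or.inl ⟨hjk, pebblePos_first _ _⟩⟩
    · exact ⟨i, Or.inr (Or.inl ⟨hjk, pebblePos_second _ _⟩)⟩
    · exact ⟨i, Or.inr (Or.inr ⟨hjk, pebblePos_third _ _⟩)⟩

/-- Nodes 0 and 2 of the path differ because their distances from `s` do. This supplies `2 ≤ Δ` for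
the geometric sums unless `D = 1`. -/
theorem two_le_degree_getVert_one {V : Type*} {G : SimpleGraph V} [G.LocallyFinite]
    (hG : G.Connected) {s t : V} {P : G.Walk s t} (hP : P.length = G.dist s t)
    (h : 2 ≤ P.length) : 2 ≤ G.degree (P.getVert 1) := by
  classical
  have h0 := dist_getVert_of_length_eq_dist hG hP (j := 0) (by omega)
  have h2 := dist_getVert_of_length_eq_dist hG hP h
  rw [← SimpleGraph.card_neighborFinset_eq_degree,
    ← Finset.card_pair (a := P.getVert 0) (b := P.getVert 2) fun h => by rw [h, h2] at h0; omega]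
  refine Finset.card_le_card fun x hx => ?_
  rw [SimpleGraph.mem_neighborFinset]
  rcases Finset.mem_insert.1 hx with rfl | hx
  · exact (P.adj_getVert_succ (i := 0) (by omega)).symm
  · rw [Finset.mem_singleton.1 hx]
    exact P.adj_getVert_succ (i := 1) (by omega)

end PebbleHunt

/-! ### The final time bound -/

theorem mainTheorem1 :
    ∃ C : ℝ, 0 < C ∧
      ∀ {V : Type*} [Fintype V] [DecidableEq V] (G : SimpleGraph V) [DecidableRel G.Adj]
        (L : PebbleHunt.PortLabelling G) (s t : V) (P : G.Walk s t) (D k η l : ℕ),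
        G.Connected → D = G.dist s t → P.length = D → (k : ℝ) < (D : ℝ) / 2 →
        η = k / 3 → l = PebbleHunt.spacing k D →
        (PebbleHunt.markerPlacement P k).card ≤ k ∧
        ∃ T : ℕ,
          PebbleHunt.treasureHuntForGraphWithMarker.VisitsAt L
            (PebbleHunt.markerPlacement P k) s t T ∧
          (T : ℝ) ≤ C * (D : ℝ) * (G.maxDegree : ℝ) ^ l ∧
          ((2 * η + 1) * l ≤ D →
            (T : ℝ) ≤ C * (D : ℝ) * (G.maxDegree : ℝ) ^ ((D : ℝ) / (2 * (η : ℝ) + 1))) := by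
  refine ⟨160, by norm_num, ?_⟩
  intro V _ _ G _ L s t P D k η l hG hD hP hk hη hl
  subst hP hη hl
  have hk' : 2 * k < P.length := by
    rw [lt_div_iff₀ two_pos] at hk
    have : k * 2 < P.length := by exact_mod_cast hk
    omega
  have hT := PebbleHunt.markedTrail_markerPlacement L hG hD hk'
  obtain ⟨h1, h2, h3, -, -, h6⟩ := PebbleHunt.spacing_bounds hk'
  have hΔ : ∀ v, G.degree v ≤ G.maxDegree := G.degree_le_maxDegree
  have hΔ1 : 1 ≤ G.maxDegree := by
    obtain ⟨p, hp, -⟩ := hT.next 0 (by omega)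
    have := hΔ (P.getVert 0)
    omega
  have hΔ2 : 2 ≤ G.maxDegree ∨ PebbleHunt.spacing k P.length = 1 := by
    by_cases h : 2 ≤ P.length
    · exact Or.inl ((PebbleHunt.two_le_degree_getVert_one hG hD h).trans (hΔ _))
    · obtain rfl : k = 0 := by omega
      right
      rw [show P.length = 1 by omega]
      rfl
  refine ⟨PebbleHunt.card_markerPlacement_le P k, ?_⟩
  obtain ⟨T, hT1, hT2⟩ := hT.exists_visitsAt hΔ hΔ1 hΔ2
  rw [P.getVert_zero, P.getVert_length] at hT1
  have hT3 : (T : ℝ) ≤ 160 * (P.length : ℝ) *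
      (G.maxDegree : ℝ) ^ PebbleHunt.spacing k P.length := by
    -- The rounding error `k / 3 + 1` is at most `D` because `2 * k < D`; this doubles the constant
    -- 80 to 160.
    have h7 : (2 * (k / 3) + 1) * PebbleHunt.spacing k P.length ≤ 2 * P.length := by omega
    have h8 := Nat.mul_le_mul_right (G.maxDegree ^ PebbleHunt.spacing k P.length) h7
    have h9 : T ≤ 160 * P.length * G.maxDegree ^ PebbleHunt.spacing k P.length := by
      rw [show 160 * P.length * G.maxDegree ^ PebbleHunt.spacing k P.length =
        80 * (2 * P.length * G.maxDegree ^ PebbleHunt.spacing k P.length) by ring]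
      exact hT2.trans (Nat.mul_le_mul_left _ h8)
    exact_mod_cast h9
  refine ⟨T, hT1, hT3, fun hle => hT3.trans ?_⟩
  refine mul_le_mul_of_nonneg_left ?_ (by positivity)
  rw [← Real.rpow_natCast]
  refine Real.rpow_le_rpow_of_exponent_le (by exact_mod_cast hΔ1) ?_
  rw [le_div_iff₀ (by positivity), mul_comm]
  exact_mod_cast hle
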